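/- Let $\pi=(n_1,\dots,n_m)$, $m\ge 2$, $n_r\ge 1$, $n_1+\dots+n_m=n$, be a partition of $n$; all $n\times n$ matrices $X=(X_{rs})$ carry the corresponding block partition, with $X_{rs}\in\mathbb C^{n_r\times n_s}$. For $i<j$ write $\widehat X_{ij}=\begin{bmatrix}X_{ii}&X_{ij}\\X_{ji}&X_{jj}\end{bmatrix}$ for the pivot submatrix. *Pivot strategy.* An ordering is a sequence $\mathcal O$ containing each pair $(r,s)$, $1\le r<s\le m$, exactly once. Two sequences are equivalent if one is obtained from the other by finitely many interchanges of adjacent pairs that are disjoint as sets; shift-equivalent if they are $[\mathcal O_1,\mathcal O_2]$ and $[\mathcal O_2,\mathcal O_1]$; weakly equivalent ($\stackrel{\mathsf w}{\sim}$) if joined by a finite chain of equivalences and shift-equivalences; permutation equivalent ($\stackrel{\mathsf p}{\sim}$) if one arises from the other by applying a permutation of $\{1,\dots,m\}$ to all indices (each pair being rewritten with its smaller index first). Let $\mathcal B_{sp}^{(m)}$ consist of the orderings that visit the columns $2,3,\dots,m$ in turn, the pairs $(s,j)$, $s<j$, of column $j$ coming in arbitrary order; those that visit the rows $m-1,m-2,\dots,1$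 in turn, the pairs $(i,s)$, $s>i$, of row $i$ coming in arbitrary order; and the reverses of all these. Let $\mathcal B_{sg}^{(m)}$ (generalized serial orderings) be the set of orderings $\mathcal O$ for which there are $\mathcal O'$ and $\mathcal O''\in\mathcal B_{sp}^{(m)}$ with $\mathcal O\stackrel{\mathsf p}{\sim}\mathcal O'\stackrel{\mathsf w}{\sim}\mathcal O''$ or $\mathcal O\stackrel{\mathsf w}{\sim}\mathcal O'\stackrel{\mathsf p}{\sim}\mathcal O''$. The cyclic strategy defined by $\mathcal O$ uses in step $k\ge 0$ the pair $(i(k),j(k))$ of $\mathcal O$ with (zero-based) position $k \bmod \frac{m(m-1)}2$. *UBC matrices.* For $0<\varrho\le 1$, $\mathrm{UBCE}_\pi(\varrho)$ with pivot pair $(i,j)$, $i<j$, is the set of unitary $V\in\mathbb C^{n\times n}$ that differ from $I_n$ at most in the blocks $V_{ii},V_{ij},V_{ji},V_{jj}$ and satisfy $\sigma_{\min}(V_{ii})=\sigma_{\min}(V_{jj})\ge\varrho\gamma_{ij}>\varrho\tilde\gamma_n$, where $$\gamma_{ij}=\max\Big\{\tfrac{3}{\sqrt{(n_j+1)(4^{n_i}+6n_j-1)}},\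 \tbinom{n_i+n_j}{n_i}^{-1/2}\Big\},\qquad \tilde\gamma_n=\tfrac{3\sqrt2}{4^n+26}.$$ *Core algorithm.* An element-wise complex Jacobi method maps a Hermitian matrix $H$ to a sequence of rotations $R^{(l)}$, $l\ge0$, with $H^{(0)}=H$, $H^{(l+1)}=(R^{(l)})^*H^{(l)}R^{(l)}$, where for some pair $p\ne q$ chosen by the method $R^{(l)}$ differs from the identity only in the submatrix $\begin{bmatrix}\cos\phi&-e^{\imath\alpha}\sin\phi\\ e^{-\imath\alpha}\sin\phi&\cos\phi\end{bmatrix}$ at the rows and columns $p,q$; here, with $h$ denoting the entries of $H^{(l)}$, $\alpha=\arg h_{pq}$, $\tan2\phi=2|h_{pq}|/(h_{pp}-h_{qq})$, $\phi\in[-\frac\pi4,\frac\pi4]$ ($\phi=\pm\frac\pi4$ if $h_{pp}=h_{qq}$ and $h_{pq}\neq0$; $\phi=0$ if $h_{pq}=0$). The method is convergent if for every Hermitian $H$ the matrices $H^{(l)}$ converge to a diagonal matrix. Its output for $H$ is the limit $W$ of the products $R^{(0)}R^{(1)}\cdots R^{(l)}$ or, if these do not converge, any accumulation point $W$ of them.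 *Attribute $\mathsf R$.* Fix such a method for the pivot submatrices at each position $(i,j)$. A core algorithm with attribute $\mathsf R$, applied to a Hermitian pivot submatrix $\widehat H_{ij}$, delivers $\widehat U=W\widetilde P$. Here $W$ is an output of the method for $\widehat H_{ij}$. The QR algorithm with column pivoting is applied to the first block row $[W_{ii}\ W_{ij}]$ of $W$: in step $r=1,\dots,n_i$ it interchanges column $r$ with a column $r'\ge r$ whose part in the rows $r,\dots,n_i$ has the largest norm, and then annihilates column $r$ below its $r$-th entry by a unitary transformation of the rows $r,\dots,n_i$. If $\tilde r$ is the smallest $r$ with $r'>n_i$, then $\widetilde P=I_{\tilde r\tilde r'}\cdots I_{n_in_i'}$, where $I_{rr'}$ is the transposition matrix of order $n_i+n_j$; if there is no such $r$, then $\widetilde P=I$. **Theorem.** Let $A\in\mathbb C^{n\times n}$ be normal, $A=B+\imath C$ with $B=\frac12(A+A^*)$ and $C=\frac{\imath}{2}(A^*-A)$. Let $\mathcal O\in\mathcal B_{sg}^{(m)}$ and $0<\varrho\le1$, and let the core algorithm be any convergent element-wise complex Jacobi method, with attribute $\mathsf R$. Let $A^{(0)}=A$ and $A^{(k+1)}=(U^{(k)})^*A^{(k)}U^{(k)}$,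 $k\ge0$, and write $A^{(k)}=B^{(k)}+\imath C^{(k)}$ with $B^{(k)},C^{(k)}$ Hermitian. Suppose that for all $k\geq 0$, with $(i,j)=(i(k),j(k))$ given by the cyclic strategy defined by $\mathcal O$, $U^{(k)}\in\mathrm{UBCE}_\pi(\varrho)$ has pivot pair $(i,j)$, and its pivot submatrix is delivered by the core algorithm with attribute $\mathsf R$ for $\widehat B^{(k)}_{ij}$ and diagonalizes $\widehat B^{(k)}_{ij}$. If $B$ has simple eigenvalues, then $$\lim_{k\to\infty}A^{(k)}=\mathrm{diag}(\lambda_1,\dots,\lambda_n),$$ where $\lambda_1,\dots,\lambda_n$ are the eigenvalues of $A$, with multiplicity, in some order. The same is true if for every $k$ the pivot submatrix of $U^{(k)}$ is instead delivered by the core algorithm for $\widehat C^{(k)}_{ij}$ and diagonalizes $\widehat C^{(k)}_{ij}$, and $C$ has simple eigenvalues. -/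

import Mathlib

open Matrix Filter Topology

noncomputable section

namespace BlockJacobi

/-! ### Pivot orderings -/

/-- An ordering of the set `{(r, s) | r < s}` of pivot positions of an `m × m` block matrix:
a finite sequence in which each of these pairs appears exactly once. -/
def IsOrdering {m : ℕ} (O : List (Fin m × Fin m)) : Prop :=
  O.Nodup ∧ ∀ p : Fin m × Fin m, p ∈ O ↔ p.1 < p.2

/-- `O'` arises from `O` by one admissible transposition: two adjacent pairs that are disjoint
as sets are interchanged. -/
def AdmissibleTransposition {m : ℕ} (O O' : List (Fin m × Fin m)) : Prop :=
  ∃ (L₁ L₂ : List (Fin m × Fin m)) (p q : Fin m × Fin m),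
    Disjoint ({p.1, p.2} : Set (Fin m)) {q.1, q.2} ∧
    O = L₁ ++ p :: q :: L₂ ∧ O' = L₁ ++ q :: p :: L₂

/-- Equivalent sequences: finitely many admissible transpositions. -/
def Equivalent {m : ℕ} : List (Fin m × Fin m) → List (Fin m × Fin m) → Prop :=
  Relation.ReflTransGen AdmissibleTransposition

/-- Shift-equivalent sequences: `O = [O₁, O₂]` and `O' = [O₂, O₁]`. -/
def ShiftEquivalent {m : ℕ} (O O' : List (Fin m × Fin m)) : Prop :=
  ∃ O₁ O₂ : List (Fin m × Fin m), O = O₁ ++ O₂ ∧ O' = O₂ ++ O₁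

/-- Weakly equivalent sequences: a finite chain of equivalences and shift-equivalences. -/
def WeakEquivalent {m : ℕ} : List (Fin m × Fin m) → List (Fin m × Fin m) → Prop :=
  Relation.ReflTransGen fun O O' => Equivalent O O' ∨ ShiftEquivalent O O'

/-- Permutation-equivalent sequences: `O' = O(q)` for a permutation `q` of the block indices.
The image of a pivot pair is again written with its smaller index first. -/
def PermEquivalent {m : ℕ} (O O' : List (Fin m × Fin m)) : Prop :=
  ∃ q : Equiv.Perm (Fin m),
    O' = O.map fun p => (min (q p.1) (q p.2), max (q p.1) (q p.2))

/-- Column-wise serial orderings with permutations: the columns `j` are taken from left to right,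
and inside column `j` the rows `s < j` are visited in an arbitrary order `τ j`. -/
def colSerial (m : ℕ) : Set (List (Fin m × Fin m)) :=
  {O | ∃ τ : Fin m → Equiv.Perm (Fin m), (∀ j s, s < j → τ j s < j) ∧
    O = (List.finRange m).flatMap fun j =>
      ((List.finRange m).filter fun s => s < j).map fun s => (τ j s, j)}

/-- Row-wise serial orderings with permutations: the rows `i` are taken from bottom to top,
and inside row `i` the columns `s > i` are visited in an arbitrary order `τ i`. -/
def rowSerial (m : ℕ) : Set (List (Fin m × Fin m)) :=
  {O | ∃ τ : Fin m → Equiv.Perm (Fin m), (∀ i s, i < s → i < τ i s) ∧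
    O = (List.finRange m).reverse.flatMap fun i =>
      ((List.finRange m).filter fun s => i < s).map fun s => (i, τ i s)}

/-- Serial orderings with permutations: column-wise, row-wise, and the reverses of these. -/
def serialPerm (m : ℕ) : Set (List (Fin m × Fin m)) :=
  {O | O ∈ colSerial m ∨ O.reverse ∈ colSerial m ∨ O ∈ rowSerial m ∨ O.reverse ∈ rowSerial m}

/-- Generalized serial orderings. -/
def generalizedSerial (m : ℕ) : Set (List (Fin m × Fin m)) :=
  {O | IsOrdering O ∧ ∃ O' O'' : List (Fin m × Fin m), O'' ∈ serialPerm m ∧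
    ((PermEquivalent O O' ∧ WeakEquivalent O' O'') ∨
      (WeakEquivalent O O' ∧ PermEquivalent O' O''))}

/-- `pivot` is the cyclic pivot strategy defined by the ordering `O`: step `k` uses the pair at
place `k mod M`, where `M` is the length of `O`. -/
def IsCyclicStrategy {m : ℕ} (O : List (Fin m × Fin m)) (pivot : ℕ → Fin m × Fin m) : Prop :=
  ∀ k, O[k % O.length]? = some (pivot k)

/-! ### Block matrices

For block sizes `ν : Fin m → ℕ`, the index `⟨r, a⟩ : BlockIndex ν` is the `a`-th index inside the
`r`-th block, so `Matrix (BlockIndex ν) (BlockIndex ν) ℂ` is the space of complex `n × n` matrices,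
`n = ∑ r, ν r`, carrying the block partition `(ν 0, …, ν (m - 1))`. -/

/-- Row and column indices of a block matrix with block sizes `ν`. -/
abbrev BlockIndex {m : ℕ} (ν : Fin m → ℕ) : Type := Σ r : Fin m, Fin (ν r)

/-- Square block matrices with block sizes `ν`. -/
abbrev BlockMatrix {m : ℕ} (ν : Fin m → ℕ) : Type := Matrix (BlockIndex ν) (BlockIndex ν) ℂ

/-- Indices of a pivot submatrix: those of block `i` followed by those of block `j`. -/
abbrev PivotIndex {m : ℕ} (ν : Fin m → ℕ) (i j : Fin m) : Type := Fin (ν i) ⊕ Fin (ν j)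

/-- The block `A_{rs}`. -/
def block {m : ℕ} {ν : Fin m → ℕ} (A : BlockMatrix ν) (r s : Fin m) :
    Matrix (Fin (ν r)) (Fin (ν s)) ℂ :=
  Matrix.of fun a b => A ⟨r, a⟩ ⟨s, b⟩

/-- The pivot submatrix `[A_{ii} A_{ij}; A_{ji} A_{jj}]`. -/
def pivotSub {m : ℕ} {ν : Fin m → ℕ} (A : BlockMatrix ν) (i j : Fin m) :
    Matrix (PivotIndex ν i j) (PivotIndex ν i j) ℂ :=
  Matrix.fromBlocks (block A i i) (block A i j) (block A j i) (block A j j)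

/-- `V` differs from the identity matrix at most in the blocks `(i,i)`, `(i,j)`, `(j,i)`,
`(j,j)`. Such a `V` is the embedding of `pivotSub V i j` into the identity matrix. -/
def IsElementary {m : ℕ} {ν : Fin m → ℕ} (i j : Fin m) (V : BlockMatrix ν) : Prop :=
  ∀ x y : BlockIndex ν, ¬((x.1 = i ∨ x.1 = j) ∧ (y.1 = i ∨ y.1 = j)) →
    V x y = (1 : BlockMatrix ν) x y

/-- The smallest singular value of a `p × p` matrix, `p ≥ 1`. (Mathlib lists the singular values
in decreasing order, starting at index `0`.) -/
def sigmaMin {p : ℕ} (V : Matrix (Fin p) (Fin p) ℂ) : ℝ :=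
  (Matrix.toEuclideanLin V).singularValues (p - 1)

/-- The number `γ_{ij}`, in terms of the block sizes `p = n_i` and `q = n_j`. -/
def gammaBound (p q : ℕ) : ℝ :=
  max (3 / √(((q : ℝ) + 1) * ((4 : ℝ) ^ p + 6 * (q : ℝ) - 1)))
    (1 / √((p + q).choose p : ℝ))

/-- The number `γ̃_n`. -/
def gammaTilde (n : ℕ) : ℝ := 3 * √2 / ((4 : ℝ) ^ n + 26)

/-- Unitary elementary UBC (uniformly bounded cosine) block matrices with pivot pair `(i, j)` and
parameter `ϱ`. -/
structure IsUBCE {m : ℕ} (ν : Fin m → ℕ) (ϱ : ℝ) (i j : Fin m) (V : BlockMatrix ν) : Prop where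
  unitary : V ∈ Matrix.unitaryGroup (BlockIndex ν) ℂ
  elementary : IsElementary i j V
  sigma_eq : sigmaMin (block V i i) = sigmaMin (block V j j)
  sigma_ge : ϱ * gammaBound (ν i) (ν j) ≤ sigmaMin (block V i i)
  gamma_gt : ϱ * gammaTilde (∑ r, ν r) < ϱ * gammaBound (ν i) (ν j)

/-! ### Element-wise complex Jacobi methods -/

/-- `R` is a complex Jacobi rotation for the Hermitian matrix `H` at the pivot positions `p ≠ q`,
`[cos φ, -e^{iα} sin φ; e^{-iα} sin φ, cos φ]` with `α = arg h_{pq}`, `φ ∈ [-π/4, π/4]` and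
`tan 2φ = 2|h_{pq}| / (h_{pp} - h_{qq})`. The last relation is written without quotients, so that
`φ = ± π/4` when `h_{pp} = h_{qq}` and `h_{pq} ≠ 0`; if `h_{pq} = 0` then `φ = 0`.
The pairs `(p, q)` and `(q, p)` give the same rotations (replace `φ`, `α` by `-φ`, `-α`). -/
def IsJacobiRotation {ι : Type*} [DecidableEq ι] (H : Matrix ι ι ℂ) (p q : ι)
    (R : Matrix ι ι ℂ) : Prop :=
  ∃ φ : ℝ, -(Real.pi / 4) ≤ φ ∧ φ ≤ Real.pi / 4 ∧
    ((H p p).re - (H q q).re) * Real.sin (2 * φ) = 2 * ‖H p q‖ * Real.cos (2 * φ) ∧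
    (H p q = 0 → φ = 0) ∧
    R p p = (Real.cos φ : ℂ) ∧
    R p q = -(Complex.exp ((H p q).arg * Complex.I) * (Real.sin φ : ℂ)) ∧
    R q p = Complex.exp (-((H p q).arg * Complex.I)) * (Real.sin φ : ℂ) ∧
    R q q = (Real.cos φ : ℂ) ∧
    ∀ x y, ¬((x = p ∨ x = q) ∧ (y = p ∨ y = q)) → R x y = (1 : Matrix ι ι ℂ) x y

/-- The accumulated product `R 0 * R 1 * ⋯ * R (l - 1)`. -/
def rotProd {ι : Type*} [Fintype ι] [DecidableEq ι] (R : ℕ → Matrix ι ι ℂ) : ℕ → Matrix ι ι ℂ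
  | 0 => 1
  | l + 1 => rotProd R l * R l

/-- An element-wise complex Jacobi method for Hermitian matrices with index set `ι`: to an input
`H` it assigns a sequence of rotations, the `l`-th of which is a Jacobi rotation, at pivot
positions chosen by the method, for the `l`-th iterate `H^{(l)}`. -/
structure JacobiMethod (ι : Type*) [Fintype ι] [DecidableEq ι] where
  rot : Matrix ι ι ℂ → ℕ → Matrix ι ι ℂ
  isRotation : ∀ H : Matrix ι ι ℂ, H.IsHermitian → ∀ l : ℕ, ∃ p q : ι, p ≠ q ∧
    IsJacobiRotation ((rotProd (rot H) l)ᴴ * H * rotProd (rot H) l) p q (rot H l)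

namespace JacobiMethod

variable {ι : Type*} [Fintype ι] [DecidableEq ι]

/-- The iterates `H^{(0)} = H`, `H^{(l+1)} = (R^{(l)})^* H^{(l)} R^{(l)}`. -/
def iter (J : JacobiMethod ι) (H : Matrix ι ι ℂ) (l : ℕ) : Matrix ι ι ℂ :=
  (rotProd (J.rot H) l)ᴴ * H * rotProd (J.rot H) l

/-- The method converges: for every Hermitian input the iterates converge to a diagonal matrix. -/
def Convergent (J : JacobiMethod ι) : Prop :=
  ∀ H : Matrix ι ι ℂ, H.IsHermitian →
    ∃ d : ι → ℂ, Tendsto (J.iter H) atTop (𝓝 (Matrix.diagonal d))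

/-- `W` is an eigenvector matrix computed by the method from the input `H`: the limit of the
accumulated products of rotations or, should these not converge, any accumulation point. -/
def IsOutput (J : JacobiMethod ι) (H W : Matrix ι ι ℂ) : Prop :=
  MapClusterPt W atTop (rotProd (J.rot H))

end JacobiMethod

/-! ### QR factorization with column pivoting and attribute R -/

/-- `c` records a run of the QR algorithm with column pivoting on the `p × (p + q)` matrix `Y`:
step `r` interchanges the columns `r` and `c r`. Here `Z r` is the matrix before step `r`; the
column `c r` has, among the columns `r, r + 1, …`, maximal norm in the rows `r, r + 1, …`; after
the interchange a unitary matrix `diag(I, Q)` acting on the rows `r, r + 1, …` (a Householder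
matrix, or a product of rotations) annihilates column `r` below its `r`-th entry. -/
def IsPivotedQR {p q : ℕ} (Y : Matrix (Fin p) (Fin p ⊕ Fin q) ℂ)
    (c : Fin p → Fin p ⊕ Fin q) : Prop :=
  ∃ (Z : ℕ → Matrix (Fin p) (Fin p ⊕ Fin q) ℂ) (Q : Fin p → Matrix (Fin p) (Fin p) ℂ),
    Z 0 = Y ∧ ∀ r : Fin p,
      (∀ s, c r = Sum.inl s → r ≤ s) ∧
      (∀ t : Fin p ⊕ Fin q, (∀ s, t = Sum.inl s → r ≤ s) →
        ∑ a ∈ Finset.Ici r, ‖Z r a t‖ ^ 2 ≤ ∑ a ∈ Finset.Ici r, ‖Z r a (c r)‖ ^ 2) ∧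
      Q r ∈ Matrix.unitaryGroup (Fin p) ℂ ∧
      (∀ a b, a < r ∨ b < r → Q r a b = (1 : Matrix (Fin p) (Fin p) ℂ) a b) ∧
      Z ((r : ℕ) + 1) = (Q r)ᴴ * (Z r * Matrix.swap ℂ (Sum.inl r) (c r)) ∧
      ∀ a, r < a → Z ((r : ℕ) + 1) a (Sum.inl r) = 0

/-- The permutation matrix used by a core algorithm with attribute R. If the column pivoting
yields `I_{11'} I_{22'} ⋯ I_{pp'}`, then the leading factors `I_{rr'}` with `r' ≤ p` are dropped,
so that the product starts with the first factor for which `r' > p`; it is the identity matrix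
if there is no such factor. -/
def permR {p q : ℕ} (c : Fin p → Fin p ⊕ Fin q) : Matrix (Fin p ⊕ Fin q) (Fin p ⊕ Fin q) ℂ :=
  (((List.finRange p).dropWhile fun r => (c r).isLeft).map
    fun r => Matrix.swap ℂ (Sum.inl r) (c r)).prod

/-! ### The block Jacobi step -/

/-- A core algorithm: an element-wise Jacobi method for the pivot submatrices of each position. -/
abbrev CoreAlgorithm {m : ℕ} (ν : Fin m → ℕ) : Type :=
  ∀ i j : Fin m, JacobiMethod (PivotIndex ν i j)

/-- The pivot submatrix of the block matrix `U` is delivered by the core algorithm `core` with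
attribute R, run on the pivot submatrix of the Hermitian matrix `H` at position `(i, j)`: it is
`W * permR c`, where `W` is the eigenvector matrix computed by the element-wise method and `c` is
given by QR with column pivoting of the first block row `[W_{ii} W_{ij}]` of `W`. It diagonalizes
the pivot submatrix of `H`. -/
def IsCoreTransformation {m : ℕ} {ν : Fin m → ℕ} (core : CoreAlgorithm ν) (i j : Fin m)
    (H U : BlockMatrix ν) : Prop :=
  (∃ (W : Matrix (PivotIndex ν i j) (PivotIndex ν i j) ℂ) (c : Fin (ν i) → PivotIndex ν i j),
    (core i j).IsOutput (pivotSub H i j) W ∧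
    IsPivotedQR (W.submatrix Sum.inl id) c ∧
    pivotSub U i j = W * permR c) ∧
  ((pivotSub U i j)ᴴ * pivotSub H i j * pivotSub U i j).IsDiag

/-! ### Normal matrices -/

/-- The Hermitian part `B = (A + A^*) / 2`. -/
def hermPart {ι : Type*} (A : Matrix ι ι ℂ) : Matrix ι ι ℂ := (1 / 2 : ℂ) • (A + Aᴴ)

/-- The matrix `C = i (A^* - A) / 2` with `A = B + i C`; `i C` is the skew-Hermitian part. -/
def imPart {ι : Type*} (A : Matrix ι ι ℂ) : Matrix ι ι ℂ := (Complex.I / 2 : ℂ) • (Aᴴ - A)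

/-- All eigenvalues are simple: the characteristic polynomial has no multiple root. -/
def HasSimpleEigenvalues {ι : Type*} [Fintype ι] [DecidableEq ι] (A : Matrix ι ι ℂ) : Prop :=
  A.charpoly.roots.Nodup

/-- The sequence `A 0, A 1, …` converges to a diagonal matrix whose diagonal entries are the
eigenvalues of `A 0`, listed with their multiplicities. -/
def ConvergesToEigenvalues {ι : Type*} [Fintype ι] [DecidableEq ι] (A : ℕ → Matrix ι ι ℂ) : Prop :=
  ∃ lam : ι → ℂ, (A 0).charpoly.roots = Finset.univ.val.map lam ∧
    Tendsto A atTop (𝓝 (Matrix.diagonal lam))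

end BlockJacobi

end

open BlockJacobi

/-! Let `H k` be the Hermitian matrix driving the process (the Hermitian part of `A k`, or its
imaginary part). Two things are needed: the off-norm of `H k` tends to zero, and the diagonal
entries eventually stop being permuted. Off-norm. A step lowers `offSq (H k)` by exactly the
off-diagonal mass of the pivot submatrix (`offSq_conj_add`), so this mass tends to zero. By
compactness, the process restarted at the beginnings of suitable cycles converges to a limit
process, made of steps `ExactStep`, whose pivot submatrices are diagonal already before each step
and whose off-norm is constant. The UBC condition bounds the determinants of the diagonal pivot
blocks from below, so these blocks stay nonsingular in the limit. Then exact cycling along a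
generalized serial ordering forces block diagonality (`forcesBlockDiag_of_mem_generalizedSerial`): a
column-by-column argument (`ColumnState.step`) handles the column-wise serial orderings, and
relabelling, time reversal, commutation and shifts give the rest. Hence the constant off-norm is
zero (`tendsto_offSq_zero`). Diagonal. Since the spectrum is simple, the diagonal entries are
eventually uniformly separated (`exists_diag_gap`). A rotation with angle in [-π/4, π/4] moves a
diagonal entry by at most the modulus of the pivot entry, too little to jump from one eigenvalue to
another. So on a nearly diagonal submatrix the element-wise method keeps the order of the
eigenvalues, its output `W` has small off-diagonal entries, and pivoted QR takes no column from the
second block (`IsPivotedQR.isLeft`); the permutation of attribute R is then trivial. Therefore each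
diagonal entry of `H k` stays near one fixed eigenvalue, and `H k` converges
(`tendsto_diagonal_of_diag_change`). Finally, `A 0` commutes with `H 0`, which has simple spectrum,
so `A 0 = P(H 0)` for a polynomial `P` (`exists_eq_aeval_of_commute`). This relation survives
unitary similarity, and `A k = P(H k)` converges as well. -/

set_option linter.unusedSectionVars false

noncomputable section

namespace BlockJacobi

/-! ### Exact steps

The limit points of a block Jacobi process are processes whose pivot submatrices are diagonal
already before each step. -/

section ExactStep

variable {m : ℕ} {ι : Type*} [Fintype ι] [DecidableEq ι]

/-- All off-diagonal entries of `H` with both indices in the blocks `i` and `j` vanish; the block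
of an index is given by `b`. -/
def PivotDiag (b : ι → Fin m) (i j : Fin m) (H : Matrix ι ι ℂ) : Prop :=
  ∀ x y, (b x = i ∨ b x = j) → (b y = i ∨ b y = j) → x ≠ y → H x y = 0

/-- `U` differs from the identity at most at positions with both indices in the blocks
`i` and `j`. -/
def IsElementaryAt (b : ι → Fin m) (i j : Fin m) (U : Matrix ι ι ℂ) : Prop :=
  ∀ x y, ¬((b x = i ∨ b x = j) ∧ (b y = i ∨ b y = j)) → U x y = (1 : Matrix ι ι ℂ) x y

/-- The determinant of the diagonal block `i` of `U`. -/
def blockDet (b : ι → Fin m) (i : Fin m) (U : Matrix ι ι ℂ) : ℂ :=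
  (U.submatrix (Subtype.val : {x // b x = i} → ι) Subtype.val).det

/-- A unitary elementary similarity with nonsingular diagonal blocks, such that the pivot
submatrix is diagonal both before and after it. -/
def ExactStep (b : ι → Fin m) (i j : Fin m) (H H' : Matrix ι ι ℂ) : Prop :=
  ∃ U : Matrix ι ι ℂ, Uᴴ * U = 1 ∧ IsElementaryAt b i j U ∧ blockDet b i U ≠ 0 ∧
    blockDet b j U ≠ 0 ∧ H.IsHermitian ∧ H' = Uᴴ * H * U ∧ PivotDiag b i j H ∧ PivotDiag b i j H'

variable {b : ι → Fin m} {i j : Fin m} {H H' U : Matrix ι ι ℂ}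

lemma PivotDiag.symm (h : PivotDiag b i j H) : PivotDiag b j i H :=
  fun x y hx hy => h x y hx.symm hy.symm

lemma IsElementaryAt.symm (h : IsElementaryAt b i j U) : IsElementaryAt b j i U :=
  fun x y hxy => h x y (by tauto)

lemma IsElementaryAt.conjTranspose (h : IsElementaryAt b i j U) : IsElementaryAt b i j Uᴴ := by
  intro x y hxy
  rw [conjTranspose_apply, h y x (by tauto), ← conjTranspose_apply, conjTranspose_one]

lemma blockDet_conjTranspose : blockDet b i Uᴴ = star (blockDet b i U) := by
  rw [blockDet, blockDet, ← det_conjTranspose, conjTranspose_submatrix]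

lemma ExactStep.symm (h : ExactStep b i j H H') : ExactStep b j i H H' := by
  obtain ⟨U, h1, h2, h3, h4, h5, h6, h7, h8⟩ := h
  exact ⟨U, h1, h2.symm, h4, h3, h5, h6, h7.symm, h8.symm⟩

/-- The notion is symmetric in time: `Uᴴ` undoes the step, and its diagonal blocks have the
conjugate determinants. This is what allows reversed orderings to be treated by running a process
backwards. -/
lemma ExactStep.reverse (h : ExactStep b i j H H') : ExactStep b i j H' H := by
  obtain ⟨U, h1, h2, h3, h4, h5, h6, h7, h8⟩ := h
  have h1' : U * Uᴴ = 1 := mul_eq_one_comm.mp h1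
  refine ⟨Uᴴ, by simpa using h1', h2.conjTranspose, ?_, ?_, ?_, ?_, h8, h7⟩
  · rw [blockDet_conjTranspose]; exact star_ne_zero.mpr h3
  · rw [blockDet_conjTranspose]; exact star_ne_zero.mpr h4
  · rw [h6]; exact isHermitian_conjTranspose_mul_mul U h5
  · rw [h6, conjTranspose_conjTranspose]
    simp only [← mul_assoc]
    rw [h1', one_mul, mul_assoc, h1', mul_one]

lemma ExactStep.isHermitian (h : ExactStep b i j H H') : H.IsHermitian := by
  obtain ⟨U, h1, h2, h3, h4, h5, h6, h7, h8⟩ := h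
  exact h5

lemma ExactStep.isHermitian' (h : ExactStep b i j H H') : H'.IsHermitian :=
  h.reverse.isHermitian

lemma ExactStep.pivotDiag (h : ExactStep b i j H H') : PivotDiag b i j H := by
  obtain ⟨U, h1, h2, h3, h4, h5, h6, h7, h8⟩ := h
  exact h7

lemma ExactStep.pivotDiag' (h : ExactStep b i j H H') : PivotDiag b i j H' :=
  h.reverse.pivotDiag

lemma IsElementaryAt.conj_apply (h : IsElementaryAt b i j U) {x : ι} (hxi : b x ≠ i)
    (hxj : b x ≠ j) (y : ι) : (Uᴴ * H * U) x y = (H * U) x y := by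
  rw [mul_assoc, mul_apply, Finset.sum_eq_single x]
  · rw [h.conjTranspose x x (by tauto), one_apply_eq, one_mul]
  · intro z _ hz
    rw [h.conjTranspose x z (by tauto), one_apply_ne hz.symm, zero_mul]
  · simp

lemma IsElementaryAt.mul_apply_of_ne (h : IsElementaryAt b i j U) {y : ι} (hyi : b y ≠ i)
    (hyj : b y ≠ j) (x : ι) : (H * U) x y = H x y := by
  rw [mul_apply, Finset.sum_eq_single y]
  · rw [h y y (by tauto), one_apply_eq, mul_one]
  · intro z _ hz
    rw [h z y (by tauto), one_apply_ne hz, mul_zero]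
  · simp

lemma ExactStep.apply_of_ne (h : ExactStep b i j H H') {x y : ι} (hxi : b x ≠ i) (hxj : b x ≠ j)
    (hyi : b y ≠ i) (hyj : b y ≠ j) : H' x y = H x y := by
  obtain ⟨U, h1, h2, h3, h4, h5, rfl, h7, h8⟩ := h
  rw [h2.conj_apply hxi hxj, h2.mul_apply_of_ne hyi hyj]

/-- Outside the pivot rows only the right factor acts, multiplying the pivot part of row `x` by the
pivot submatrix of `U`. -/
lemma ExactStep.row_eq_zero (h : ExactStep b i j H H') {x : ι} (hxi : b x ≠ i) (hxj : b x ≠ j)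
    (h0 : ∀ z, (b z = i ∨ b z = j) → H x z = 0) {y : ι} (hy : b y = i ∨ b y = j) :
    H' x y = 0 := by
  obtain ⟨U, h1, h2, h3, h4, h5, rfl, h7, h8⟩ := h
  rw [h2.conj_apply hxi hxj, mul_apply]
  refine Finset.sum_eq_zero fun z _ => ?_
  by_cases hz : b z = i ∨ b z = j
  · rw [h0 z hz, zero_mul]
  · rw [h2 z y (by tauto), one_apply_ne, mul_zero]
    rintro rfl
    exact hz hy

/-- In block notation `H'_{xj} = H_{xi} U_{ij} + H_{xj} U_{jj}`. The left side and the first term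
vanish, and `U_{jj}` is nonsingular. This is where the nonsingularity of the diagonal blocks is
exploited. -/
lemma ExactStep.row_eq_zero_of (h : ExactStep b i j H H') {x : ι} (hxi : b x ≠ i)
    (hxj : b x ≠ j) (h0 : ∀ z, b z = i → H x z = 0) (h0' : ∀ z, b z = j → H' x z = 0)
    {y : ι} (hy : b y = j) : H x y = 0 := by
  obtain ⟨U, h1, h2, h3, h4, h5, rfl, h7, h8⟩ := h
  have key : (fun z : {z // b z = j} => H x z) ᵥ*
      (U.submatrix (Subtype.val : {x // b x = j} → ι) (Subtype.val : {x // b x = j} → ι)) = 0 := by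
    ext ⟨y, hy⟩
    have hxy := h0' y hy
    rw [h2.conj_apply hxi hxj, mul_apply] at hxy
    rw [Pi.zero_apply, ← hxy, vecMul, dotProduct]
    simp only [submatrix_apply]
    rw [← Finset.sum_subtype (Finset.univ.filter fun z => b z = j) (by simp)
      (fun z => H x z * U z y)]
    refine Finset.sum_subset (Finset.subset_univ _) fun z _ hz => ?_
    have hzj : b z ≠ j := by simpa using hz
    by_cases hzi : b z = i
    · rw [h0 z hzi, zero_mul]
    · rw [h2 z y (by tauto), one_apply_ne, mul_zero]
      rintro rfl
      exact hzj hy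
  exact congrFun (eq_zero_of_vecMul_eq_zero h4 key) ⟨y, hy⟩

/-! ### Chains of exact steps -/

/-- All entries of `H` outside the diagonal blocks vanish. -/
def OffBlockZero (b : ι → Fin m) (H : Matrix ι ι ℂ) : Prop :=
  ∀ x y, b x ≠ b y → H x y = 0

/-- `H'` arises from `H` by exact steps with the pivot pairs in the list. -/
def ExactChain (b : ι → Fin m) : List (Fin m × Fin m) → Matrix ι ι ℂ → Matrix ι ι ℂ → Prop
  | [], H, H' => H = H'
  | p :: L, H, H' => ∃ G, ExactStep b p.1 p.2 H G ∧ ExactChain b L G H'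

lemma ExactStep.offBlockZero (h : ExactStep b i j H H') (h0 : OffBlockZero b H) :
    OffBlockZero b H' := by
  intro x y hxy
  by_cases hx : b x = i ∨ b x = j
  · by_cases hy : b y = i ∨ b y = j
    · exact h.pivotDiag' x y hx hy fun e => hxy (congrArg b e)
    · rw [← h.isHermitian'.apply]
      rw [h.row_eq_zero (by tauto) (by tauto) (fun z hz => h0 y z ?_) hx, star_zero]
      intro e
      exact hy (e ▸ hz)
  · by_cases hy : b y = i ∨ b y = j
    · refine h.row_eq_zero (by tauto) (by tauto) (fun z hz => h0 x z ?_) hy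
      intro e
      exact hx (e ▸ hz)
    · rw [h.apply_of_ne (by tauto) (by tauto) (by tauto) (by tauto), h0 x y hxy]

lemma exactChain_append {L₁ L₂ : List (Fin m × Fin m)} :
    ExactChain b (L₁ ++ L₂) H H' ↔ ∃ G, ExactChain b L₁ H G ∧ ExactChain b L₂ G H' := by
  induction L₁ generalizing H with
  | nil => simp [ExactChain]
  | cons p L ih =>
    simp only [List.cons_append, ExactChain, ih]
    constructor
    · rintro ⟨G, h1, G', h2, h3⟩
      exact ⟨G', ⟨G, h1, h2⟩, h3⟩
    · rintro ⟨G', ⟨G, h1, h2⟩, h3⟩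
      exact ⟨G, h1, G', h2, h3⟩

lemma ExactChain.offBlockZero {L : List (Fin m × Fin m)} (h : ExactChain b L H H')
    (h0 : OffBlockZero b H) : OffBlockZero b H' := by
  induction L generalizing H with
  | nil => exact h ▸ h0
  | cons p L ih =>
    obtain ⟨G, h1, h2⟩ := h
    exact ih h2 (h1.offBlockZero h0)

lemma ExactChain.reverse {L : List (Fin m × Fin m)} (h : ExactChain b L H H') :
    ExactChain b L.reverse H' H := by
  induction L generalizing H with
  | nil => exact Eq.symm h
  | cons p L ih =>
    obtain ⟨G, h1, h2⟩ := h
    rw [List.reverse_cons, exactChain_append]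
    exact ⟨G, ih h2, H, h1.reverse, rfl⟩

/-- Diagonality of the diagonal blocks is preserved, and established for the pivot blocks. -/
lemma ExactStep.diagBlock (h : ExactStep b i j H H') {s : Fin m}
    (hs : (∀ x y, b x = s → b y = s → x ≠ y → H x y = 0) ∨ s = i ∨ s = j) :
    ∀ x y, b x = s → b y = s → x ≠ y → H' x y = 0 := by
  intro x y hx hy hxy
  by_cases hsij : s = i ∨ s = j
  · exact h.pivotDiag' x y (by rwa [hx]) (by rwa [hy]) hxy
  · rw [h.apply_of_ne (hx ▸ by tauto) (hx ▸ by tauto) (hy ▸ by tauto) (hy ▸ by tauto)]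
    exact (hs.resolve_right hsij) x y hx hy hxy

lemma ExactChain.diagBlock {L : List (Fin m × Fin m)} (h : ExactChain b L H H') {s : Fin m}
    (hs : (∀ x y, b x = s → b y = s → x ≠ y → H x y = 0) ∨ ∃ p ∈ L, s = p.1 ∨ s = p.2) :
    ∀ x y, b x = s → b y = s → x ≠ y → H' x y = 0 := by
  induction L generalizing H with
  | nil =>
    obtain rfl : H = H' := h
    simpa using hs
  | cons p L ih =>
    obtain ⟨G, h1, h2⟩ := h
    refine ih h2 ?_
    rcases hs with hs | ⟨q, hq, hs⟩
    · exact Or.inl (h1.diagBlock (Or.inl hs))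
    · rcases List.mem_cons.mp hq with rfl | hq
      · exact Or.inl (h1.diagBlock (Or.inr hs))
      · exact Or.inr ⟨q, hq, hs⟩

/-- Two steps with disjoint pivot pairs may be interchanged. -/
lemma ExactStep.comm {k l : Fin m} {G : Matrix ι ι ℂ}
    (hd : Disjoint ({i, j} : Set (Fin m)) {k, l}) (h : ExactStep b i j H G)
    (h' : ExactStep b k l G H') : ∃ G', ExactStep b k l H G' ∧ ExactStep b i j G' H' := by
  obtain ⟨U, h1, h2, h3, h4, h5, h6, h7, h8⟩ := h
  obtain ⟨V, k1, k2, k3, k4, k5, k6, k7, k8⟩ := h'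
  have hd' : ∀ s, (s = i ∨ s = j) → (s = k ∨ s = l) → False := by
    intro s hs hs'
    exact Set.disjoint_left.mp hd (show s ∈ ({i, j} : Set (Fin m)) from hs) hs'
  have hUV : U * V = V * U := by
    -- `U - 1` and `V - 1` live on disjoint sets of indices, so both their products vanish;
    -- expanding gives `U V = V U`.
    have key : ∀ {X Y : Matrix ι ι ℂ} {i j k l : Fin m},
        (∀ s, (s = i ∨ s = j) → (s = k ∨ s = l) → False) →
        IsElementaryAt b i j X → IsElementaryAt b k l Y → (X - 1) * (Y - 1) = 0 := by
      intro X Y i j k l hd hX hY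
      ext x y
      rw [mul_apply, Matrix.zero_apply]
      refine Finset.sum_eq_zero fun z _ => ?_
      by_cases hz : b z = i ∨ b z = j
      · rw [sub_apply Y, hY z y fun hh => hd _ hz hh.1, sub_self, mul_zero]
      · rw [sub_apply X, hX x z fun hh => hz hh.2, sub_self, zero_mul]
    have e1 := key hd' h2 k2
    have e2 := key (fun s hs hs' => hd' s hs' hs) k2 h2
    rw [sub_mul, mul_sub, mul_sub] at e1 e2
    simp only [mul_one, one_mul] at e1 e2
    have e3 : U * V - V * U = (U * V - U - (V - 1)) - (V * U - V - (U - 1)) := by abel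
    rw [← sub_eq_zero, e3, e1, e2, sub_zero]
  have happ : ∀ {X : Matrix ι ι ℂ} {i j : Fin m} (M : Matrix ι ι ℂ), IsElementaryAt b i j X →
      ∀ x y, ¬(b x = i ∨ b x = j) → ¬(b y = i ∨ b y = j) → (Xᴴ * M * X) x y = M x y := by
    intro X i j M hX x y hx hy
    rw [hX.conj_apply (by tauto) (by tauto), hX.mul_apply_of_ne (by tauto) (by tauto)]
  have hH' : H' = Uᴴ * (Vᴴ * H * V) * U := by
    rw [k6, h6]
    calc Vᴴ * (Uᴴ * H * U) * V = (U * V)ᴴ * H * (U * V) := by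
          rw [conjTranspose_mul]; simp only [mul_assoc]
      _ = Uᴴ * (Vᴴ * H * V) * U := by
          rw [hUV, conjTranspose_mul]; simp only [mul_assoc]
  refine ⟨Vᴴ * H * V, ⟨V, k1, k2, k3, k4, h5, rfl, ?_, ?_⟩,
    ⟨U, h1, h2, h3, h4, isHermitian_conjTranspose_mul_mul V h5, hH', ?_, ?_⟩⟩
  · intro x y hx hy hxy
    have := k7 x y hx hy hxy
    rwa [h6, happ H h2 x y (fun h => hd' _ h hx) (fun h => hd' _ h hy)] at this
  · intro x y hx hy hxy
    have := k8 x y hx hy hxy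
    rwa [hH', happ _ h2 x y (fun h => hd' _ h hx) (fun h => hd' _ h hy)] at this
  · intro x y hx hy hxy
    rw [happ H k2 x y (fun h => hd' _ hx h) (fun h => hd' _ hy h)]
    exact h7 x y hx hy hxy
  · intro x y hx hy hxy
    rw [k6, happ G k2 x y (fun h => hd' _ hx h) (fun h => hd' _ hy h)]
    exact h8 x y hx hy hxy

/-- A permutation of the block indices acts on the labelling alone and leaves the matrices
untouched; this is why the block of an index is given by an arbitrary function `b`. -/
lemma ExactStep.relabel (q : Equiv.Perm (Fin m)) (h : ExactStep b i j H H') :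
    ExactStep (q ∘ b) (q i) (q j) H H' := by
  obtain ⟨U, h1, h2, h3, h4, h5, h6, h7, h8⟩ := h
  have hdet : ∀ s, blockDet (q ∘ b) (q s) U = blockDet b s U := by
    intro s
    rw [blockDet, blockDet, ← det_submatrix_equiv_self
      (Equiv.subtypeEquivRight fun x => (q.injective.eq_iff : q (b x) = q s ↔ b x = s))]
    rfl
  refine ⟨U, h1, ?_, ?_, ?_, h5, h6, ?_, ?_⟩
  · intro x y hxy
    simp only [Function.comp_apply, q.injective.eq_iff] at hxy
    exact h2 x y hxy
  · rwa [hdet]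
  · rwa [hdet]
  · intro x y hx hy
    simp only [Function.comp_apply, q.injective.eq_iff] at hx hy
    exact h7 x y hx hy
  · intro x y hx hy
    simp only [Function.comp_apply, q.injective.eq_iff] at hx hy
    exact h8 x y hx hy

/-- The image of a pivot pair under a permutation, with its smaller index first. -/
def mapPair (q : Equiv.Perm (Fin m)) (p : Fin m × Fin m) : Fin m × Fin m :=
  (min (q p.1) (q p.2), max (q p.1) (q p.2))

lemma ExactChain.relabel (q : Equiv.Perm (Fin m)) {L : List (Fin m × Fin m)}
    (h : ExactChain b L H H') : ExactChain (q ∘ b) (L.map (mapPair q)) H H' := by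
  induction L generalizing H with
  | nil => exact h
  | cons p L ih =>
    obtain ⟨G, h1, h2⟩ := h
    refine ⟨G, ?_, ih h2⟩
    rcases le_total (q p.1) (q p.2) with hle | hle
    · simpa only [mapPair, min_eq_left hle, max_eq_right hle] using h1.relabel q
    · simpa only [mapPair, min_eq_right hle, max_eq_left hle] using (h1.relabel q).symm

lemma AdmissibleTransposition.exactChain {O O' : List (Fin m × Fin m)}
    (hO : AdmissibleTransposition O O') (h : ExactChain b O H H') : ExactChain b O' H H' := by
  obtain ⟨L₁, L₂, p, q, hd, rfl, rfl⟩ := hO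
  rw [exactChain_append] at h ⊢
  obtain ⟨G, h1, G₁, h2, G₂, h3, h4⟩ := h
  obtain ⟨G', k1, k2⟩ := h2.comm hd h3
  exact ⟨G, h1, G', k1, G₂, k2, h4⟩

lemma Equivalent.exactChain {O O' : List (Fin m × Fin m)}
    (hO : Equivalent O O') (h : ExactChain b O H H') : ExactChain b O' H H' := by
  induction hO with
  | refl => exact h
  | tail _ h2 ih => exact h2.exactChain ih

end ExactStep

/-! ### Orderings that diagonalize -/

section Forcing

variable {m : ℕ} {O O' : List (Fin m × Fin m)}

/-- Sufficiently many exact cycles along `O` are only possible for block diagonal matrices. -/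
def ForcesBlockDiag (ι : Type*) [Fintype ι] [DecidableEq ι] (O : List (Fin m × Fin m)) : Prop :=
  ∃ N : ℕ, ∀ (b : ι → Fin m) (H H' : Matrix ι ι ℂ),
    ExactChain b (List.replicate N O).flatten H H' → OffBlockZero b H'

variable {ι : Type*} [Fintype ι] [DecidableEq ι]

/-! ### Transport of the forcing property along the equivalences of orderings. -/

lemma ForcesBlockDiag.of_exactChain
    (h : ∀ (b : ι → Fin m) (H H' : Matrix ι ι ℂ), ExactChain b O H H' → ExactChain b O' H H')
    (hO' : ForcesBlockDiag ι O') : ForcesBlockDiag ι O := by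
  obtain ⟨N, hN⟩ := hO'
  have key : ∀ N (b : ι → Fin m) (H H' : Matrix ι ι ℂ),
      ExactChain b (List.replicate N O).flatten H H' →
      ExactChain b (List.replicate N O').flatten H H' := by
    intro N b H H' hc
    induction N generalizing H with
    | zero => exact hc
    | succ N ih =>
      rw [List.replicate_succ, List.flatten_cons, exactChain_append] at hc ⊢
      obtain ⟨G, h1, h2⟩ := hc
      exact ⟨G, h b H G h1, ih G h2⟩
  exact ⟨N, fun b H H' hc => hN b H H' (key N b H H' hc)⟩

lemma ForcesBlockDiag.of_equivalent (h : Equivalent O O') (hO' : ForcesBlockDiag ι O') :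
    ForcesBlockDiag ι O :=
  hO'.of_exactChain fun _ _ _ hc => h.exactChain hc

lemma flatten_replicate_succ_append {α : Type*} (L₁ L₂ : List α) (N : ℕ) :
    (List.replicate (N + 1) (L₁ ++ L₂)).flatten =
      L₁ ++ ((List.replicate N (L₂ ++ L₁)).flatten ++ L₂) := by
  induction N with
  | zero => simp
  | succ N ih =>
    rw [List.replicate_succ, List.flatten_cons, ih, List.replicate_succ, List.flatten_cons]
    simp only [List.append_assoc]

/-- One extra cycle absorbs the shift: `N + 1` cycles of `[O₁, O₂]` contain `N` cycles of `[O₂,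
O₁]`, and the steps of the trailing `O₂` preserve block diagonality. -/
lemma ForcesBlockDiag.of_shiftEquivalent (h : ShiftEquivalent O O')
    (hO' : ForcesBlockDiag ι O') : ForcesBlockDiag ι O := by
  obtain ⟨O₁, O₂, rfl, rfl⟩ := h
  obtain ⟨N, hN⟩ := hO'
  refine ⟨N + 1, fun b H H' hc => ?_⟩
  rw [flatten_replicate_succ_append, exactChain_append] at hc
  obtain ⟨G, _, hc⟩ := hc
  rw [exactChain_append] at hc
  obtain ⟨G', h1, h2⟩ := hc
  exact h2.offBlockZero (hN b G G' h1)

lemma ForcesBlockDiag.of_weakEquivalent (h : WeakEquivalent O O')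
    (hO' : ForcesBlockDiag ι O') : ForcesBlockDiag ι O := by
  induction h with
  | refl => exact hO'
  | tail _ h2 ih =>
    rcases h2 with h2 | h2
    · exact ih (hO'.of_equivalent h2)
    · exact ih (hO'.of_shiftEquivalent h2)

lemma ForcesBlockDiag.of_map (q : Equiv.Perm (Fin m))
    (h : ForcesBlockDiag ι (O.map (mapPair q))) : ForcesBlockDiag ι O := by
  obtain ⟨N, hN⟩ := h
  refine ⟨N, fun b H H' hc => ?_⟩
  have hc' := hc.relabel q
  rw [List.map_flatten, List.map_replicate] at hc'
  intro x y hxy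
  exact hN _ H H' hc' x y fun e => hxy (q.injective e)

lemma ForcesBlockDiag.of_permEquivalent (h : PermEquivalent O O')
    (hO' : ForcesBlockDiag ι O') : ForcesBlockDiag ι O := by
  obtain ⟨q, rfl⟩ := h
  exact hO'.of_map q

/-- Run backwards, the process follows `O.reverse` and ends in `H`, so `H` is block diagonal;
running forwards carries this over to `H'`. -/
lemma ForcesBlockDiag.of_reverse (h : ForcesBlockDiag ι O.reverse) : ForcesBlockDiag ι O := by
  obtain ⟨N, hN⟩ := h
  refine ⟨N, fun b H H' hc => ?_⟩
  have hc' := hc.reverse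
  rw [List.reverse_flatten, List.map_replicate, List.reverse_replicate] at hc'
  exact hc.offBlockZero (hN b H' H hc')

/-! ### Serial orderings -/

/-- The state of an exact process inside column `j`, when the pivots `(s, j)` with `s ∈ L` are
still to come. -/
structure ColumnState (b : ι → Fin m) (j : Fin m) (L : List (Fin m)) (H : Matrix ι ι ℂ) :
    Prop where
  isHermitian : H.IsHermitian
  eq_zero : ∀ x y, b x < j → b y < j → b x ≠ b y → (b x ∈ L ↔ b y ∈ L) → H x y = 0
  column_eq_zero : ∀ x y, b x < j → b x ∉ L → b y = j → H x y = 0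
  row_eq_zero : ∀ x, b x < j → b x ∈ L → (∀ z, b z = j → H x z = 0) →
    ∀ z, b z < j → b z ≠ b x → H x z = 0

/-- Call the blocks `< j` outside `L` visited. Within the leading part only entries between visited
and unvisited blocks may survive, visited rows vanish in column `j`, and an unvisited row that
vanishes in column `j` vanishes throughout the leading part off its own block. Diagonality of the
pivot before the step puts the rows of block `s` in the last situation, so they decouple from the
visited ones. The step can then create nothing in the visited rows, and `s` joins them. -/
lemma ColumnState.step {b : ι → Fin m} {j s : Fin m} {L : List (Fin m)} {H H' : Matrix ι ι ℂ}
    (h : ColumnState b j (s :: L) H) (hs : s < j) (hsL : s ∉ L) (hstep : ExactStep b s j H H') :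
    ColumnState b j L H' := by
  have hsrow : ∀ x, b x = s → ∀ z, b z < j → b z ≠ s → H x z = 0 := by
    rintro x rfl z hz hzs
    refine h.row_eq_zero x hs (by simp) (fun w hw => ?_) z hz hzs
    refine hstep.pivotDiag x w (Or.inl rfl) (Or.inr hw) ?_
    rintro rfl
    exact hs.ne hw
  have hvis : ∀ x, b x < j → b x ≠ s → b x ∉ L → ∀ z, (b z = s ∨ b z = j) → H' x z = 0 := by
    intro x hx hxs hxL z hz
    refine hstep.row_eq_zero hxs hx.ne (fun w hw => ?_) hz
    rcases hw with hw | hw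
    · rw [← h.isHermitian.apply, hsrow w hw x hx hxs, star_zero]
    · exact h.column_eq_zero x w hx (by simp [hxs, hxL]) hw
  refine ⟨hstep.isHermitian', ?_, ?_, ?_⟩
  · intro x y hx hy hxy hL
    by_cases hxs : b x = s
    · have hyL : b y ∉ L := fun h => hsL (hxs ▸ hL.mpr h)
      rw [← hstep.isHermitian'.apply,
        hvis y hy (fun e => hxy (hxs.trans e.symm)) hyL x (Or.inl hxs), star_zero]
    · by_cases hys : b y = s
      · have hxL : b x ∉ L := fun h => hsL (hys ▸ hL.mp h)
        exact hvis x hx hxs hxL y (Or.inl hys)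
      · rw [hstep.apply_of_ne hxs hx.ne hys hy.ne]
        exact h.eq_zero x y hx hy hxy (by simp [hxs, hys, hL])
  · intro x y hx hxL hy
    by_cases hxs : b x = s
    · refine hstep.pivotDiag' x y (Or.inl hxs) (Or.inr hy) ?_
      rintro rfl
      exact hx.ne hy
    · exact hvis x hx hxs hxL y (Or.inr hy)
  · intro x hx hxL h0 z hz hzx
    have hxs : b x ≠ s := fun e => hsL (e ▸ hxL)
    have hxs0 : ∀ w, b w = s → H x w = 0 := fun w hw =>
      h.eq_zero x w hx (hw ▸ hs) (hw ▸ hxs) (by simp [hxL, hw])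
    -- Nonsingularity of `U_{jj}` transfers the vanishing in column `j` back to the matrix before
    -- the step, where the old `row_eq_zero` applies.
    have hxj0 : ∀ w, b w = j → H x w = 0 := fun w hw =>
      hstep.row_eq_zero_of hxs hx.ne hxs0 h0 hw
    by_cases hzs : b z = s
    · exact hstep.row_eq_zero hxs hx.ne
        (fun w hw => hw.elim (hxs0 w) (hxj0 w)) (Or.inl hzs)
    · rw [hstep.apply_of_ne hxs hx.ne hzs hz.ne]
      exact h.row_eq_zero x hx (by simp [hxL]) hxj0 z hz hzx

lemma ColumnState.chain {b : ι → Fin m} {j : Fin m} {L : List (Fin m)} {H H' : Matrix ι ι ℂ}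
    (h : ColumnState b j L H) (hL : ∀ s ∈ L, s < j) (hnd : L.Nodup)
    (hc : ExactChain b (L.map fun s => (s, j)) H H') : ColumnState b j [] H' := by
  induction L generalizing H with
  | nil => exact (show H = H' from hc) ▸ h
  | cons s L ih =>
    obtain ⟨G, h1, h2⟩ := hc
    rw [List.nodup_cons] at hnd
    exact ih (h.step (hL s (by simp)) hnd.1 h1) (fun t ht => hL t (by simp [ht])) hnd.2 h2

lemma ExactChain.isHermitian {b : ι → Fin m} {L : List (Fin m × Fin m)} {H H' : Matrix ι ι ℂ}
    (hc : ExactChain b L H H') (h : H.IsHermitian) : H'.IsHermitian := by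
  induction L generalizing H with
  | nil => exact (show H = H' from hc) ▸ h
  | cons s L ih =>
    obtain ⟨G, h1, h2⟩ := hc
    exact ih h2 h1.isHermitian'

/-- When column `j` begins, the leading part is block diagonal, so the state with no block visited
holds trivially. When all blocks are visited, the state says that the leading part enlarged by block
`j` is block diagonal. -/
lemma offBlockZero_of_columns {b : ι → Fin m} (L : Fin m → List (Fin m))
    (hL : ∀ j s, s ∈ L j ↔ s < j) (hnd : ∀ j, (L j).Nodup) (n : ℕ) (hn : n ≤ m)
    {H H' : Matrix ι ι ℂ} (hH : H.IsHermitian)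
    (hc : ExactChain b (((List.finRange m).take n).flatMap fun j => (L j).map fun s => (s, j))
      H H') :
    ∀ x y, (b x : ℕ) < n → (b y : ℕ) < n → b x ≠ b y → H' x y = 0 := by
  induction n generalizing H' with
  | zero => intro x y hx; omega
  | succ n ih =>
    have hn' : n < m := by omega
    have htake : (List.finRange m).take (n + 1) = (List.finRange m).take n ++ [⟨n, hn'⟩] := by
      rw [List.take_succ_eq_append_getElem (by simpa using hn')]
      simp
    rw [htake, List.flatMap_append, exactChain_append] at hc
    obtain ⟨G, h1, h2⟩ := hc
    have hG := ih hn'.le h1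
    have hGh := h1.isHermitian hH
    set j : Fin m := ⟨n, hn'⟩ with hj
    have hlt : ∀ s : Fin m, s < j ↔ (s : ℕ) < n := fun s => Fin.lt_def
    have hst : ColumnState b j (L j) G := by
      refine ⟨hGh, ?_, ?_, ?_⟩
      · intro x y hx hy hxy _
        exact hG x y ((hlt _).mp hx) ((hlt _).mp hy) hxy
      · intro x y hx hxL
        exact absurd ((hL j _).mpr hx) hxL
      · intro x hx _ _ z hz hzx
        exact hG x z ((hlt _).mp hx) ((hlt _).mp hz) hzx.symm
    have hend := hst.chain (fun s hs => (hL j s).mp hs) (hnd j) (by simpa using h2)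
    have hle : ∀ s : Fin m, (s : ℕ) < n + 1 → s < j ∨ s = j := fun s hs =>
      (Nat.lt_succ_iff_lt_or_eq.mp hs).imp (hlt s).mpr Fin.ext
    intro x y hx hy hxy
    rcases hle _ hx with hx | hx <;> rcases hle _ hy with hy | hy
    · exact hend.eq_zero x y hx hy hxy (by simp)
    · exact hend.column_eq_zero x y hx (by simp) hy
    · rw [← hend.isHermitian.apply, hend.column_eq_zero y x hy (by simp) hx, star_zero]
    · exact absurd (hx.trans hy.symm) hxy

lemma forcesBlockDiag_of_columns (L : Fin m → List (Fin m)) (hL : ∀ j s, s ∈ L j ↔ s < j)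
    (hnd : ∀ j, (L j).Nodup) :
    ForcesBlockDiag ι ((List.finRange m).flatMap fun j => (L j).map fun s => (s, j)) := by
  refine ⟨1, fun b H H' hc => ?_⟩
  simp only [List.replicate_one, List.flatten_singleton] at hc
  -- Hermitian symmetry of `H` is read off the first step; if there is no step, there are no two
  -- distinct blocks.
  by_cases hm : ((List.finRange m).flatMap fun j => (L j).map fun s => (s, j)) = []
  · intro x y hxy
    exfalso
    rcases lt_or_gt_of_ne hxy with h | h
    · have := List.flatMap_eq_nil_iff.mp hm (b y) (List.mem_finRange _)
      rw [List.map_eq_nil_iff] at this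
      exact absurd ((hL _ _).mpr h) (by simp [this])
    · have := List.flatMap_eq_nil_iff.mp hm (b x) (List.mem_finRange _)
      rw [List.map_eq_nil_iff] at this
      exact absurd ((hL _ _).mpr h) (by simp [this])
  · have hH : H.IsHermitian := by
      obtain ⟨p, l, hpl⟩ := List.exists_cons_of_ne_nil hm
      rw [hpl] at hc
      obtain ⟨G, h1, _⟩ := hc
      exact h1.isHermitian
    intro x y
    refine offBlockZero_of_columns L hL hnd m le_rfl hH ?_ x y (b x).2 (b y).2
    rwa [List.take_of_length_le (by simp)]

/-- On a finite type, a permutation that maps a set into itself maps it onto itself. -/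
lemma mem_map_filter_perm (τ : Equiv.Perm (Fin m)) (P : Fin m → Prop) [DecidablePred P]
    (hτ : ∀ s, P s → P (τ s)) (t : Fin m) :
    t ∈ ((List.finRange m).filter fun s => P s).map τ ↔ P t := by
  have h := Equiv.Perm.perm_symm_mapsTo_of_mapsTo τ (s := {s | P s}) hτ
  simp only [List.mem_map, List.mem_filter, List.mem_finRange, true_and, decide_eq_true_eq]
  constructor
  · rintro ⟨s, hs, rfl⟩
    exact hτ s hs
  · intro ht
    exact ⟨τ.symm t, h ht, by simp⟩

lemma forcesBlockDiag_of_mem_colSerial (hO : O ∈ colSerial m) : ForcesBlockDiag ι O := by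
  obtain ⟨τ, hτ, rfl⟩ := hO
  have := forcesBlockDiag_of_columns (ι := ι)
    (fun j => ((List.finRange m).filter fun s => s < j).map (τ j))
    (fun j t => mem_map_filter_perm (τ j) (fun s => s < j) (hτ j) t)
    (fun j => ((List.nodup_finRange m).filter _).map (τ j).injective)
  simpa only [List.map_map, Function.comp_def] using this

/-- Reversing the block indices turns rows taken from bottom to top into columns taken from left to
right. -/
lemma forcesBlockDiag_of_mem_rowSerial (hO : O ∈ rowSerial m) : ForcesBlockDiag ι O := by
  obtain ⟨τ, hτ, rfl⟩ := hO
  apply ForcesBlockDiag.of_map Fin.revPerm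
  have := forcesBlockDiag_of_columns (ι := ι)
    (fun j => ((List.finRange m).filter fun s => j.rev < s).map fun s => (τ j.rev s).rev)
    (fun j t => ?_)
    (fun j => ((List.nodup_finRange m).filter _).map
      (Fin.rev_injective.comp (τ j.rev).injective))
  · rw [List.map_flatMap]
    have hrev : (List.finRange m).reverse = (List.finRange m).map Fin.rev :=
      List.finRange_reverse
    rw [hrev, List.flatMap_map]
    convert this using 2
    funext j
    rw [List.map_map, List.map_map]
    refine List.map_congr_left fun s hs => ?_
    have hs' : j.rev < s := by simpa using hs
    have hlt : (τ j.rev s).rev < j := by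
      rw [Fin.rev_lt_iff]
      exact hτ _ _ hs'
    simp [mapPair, hlt.le]
  · have h := mem_map_filter_perm (τ j.rev) (fun s => j.rev < s) (hτ j.rev) t.rev
    rw [Fin.rev_lt_rev] at h
    rw [← h]
    simp only [List.mem_map]
    exact exists_congr fun s => and_congr_right fun _ => Fin.rev_eq_iff

lemma forcesBlockDiag_of_mem_generalizedSerial (hO : O ∈ generalizedSerial m) :
    ForcesBlockDiag ι O := by
  obtain ⟨_, O', O'', hs, h⟩ := hO
  have hO'' : ForcesBlockDiag ι O'' := by
    rcases hs with hs | hs | hs | hs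
    · exact forcesBlockDiag_of_mem_colSerial hs
    · exact (forcesBlockDiag_of_mem_colSerial hs).of_reverse
    · exact forcesBlockDiag_of_mem_rowSerial hs
    · exact (forcesBlockDiag_of_mem_rowSerial hs).of_reverse
  rcases h with ⟨h1, h2⟩ | ⟨h1, h2⟩
  · exact (hO''.of_weakEquivalent h2).of_permEquivalent h1
  · exact (hO''.of_permEquivalent h2).of_weakEquivalent h1

end Forcing

/-! ### The off-norm -/

section OffNorm

variable {ι : Type*} [Fintype ι] [DecidableEq ι]

/-- The square of the Frobenius norm. -/
def frobSq (H : Matrix ι ι ℂ) : ℝ := ∑ x, ∑ y, ‖H x y‖ ^ 2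

/-- The sum of the squared moduli of the off-diagonal entries. -/
def offSq (H : Matrix ι ι ℂ) : ℝ := ∑ x, ∑ y ∈ Finset.univ.erase x, ‖H x y‖ ^ 2

/-- The entries of `H` with both indices satisfying `T`, all others being replaced by `0`. -/
def restrictTo (T : ι → Prop) [DecidablePred T] (H : Matrix ι ι ℂ) : Matrix ι ι ℂ :=
  Matrix.of fun x y => if T x ∧ T y then H x y else 0

variable {H U : Matrix ι ι ℂ} {T : ι → Prop} [DecidablePred T]

lemma frobSq_eq_diag_add_offSq (H : Matrix ι ι ℂ) :
    frobSq H = ∑ x, ‖H x x‖ ^ 2 + offSq H := by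
  rw [frobSq, offSq, ← Finset.sum_add_distrib]
  exact Finset.sum_congr rfl fun x _ => (Finset.add_sum_erase _ _ (Finset.mem_univ x)).symm

lemma offSq_nonneg (H : Matrix ι ι ℂ) : 0 ≤ offSq H :=
  Finset.sum_nonneg fun _ _ => Finset.sum_nonneg fun _ _ => by positivity

lemma row_le_offSq (H : Matrix ι ι ℂ) (x : ι) :
    ∑ y ∈ Finset.univ.erase x, ‖H x y‖ ^ 2 ≤ offSq H :=
  Finset.single_le_sum (f := fun x => ∑ y ∈ Finset.univ.erase x, ‖H x y‖ ^ 2)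
    (fun _ _ => Finset.sum_nonneg fun _ _ => by positivity) (Finset.mem_univ x)

lemma sq_norm_le_offSq (H : Matrix ι ι ℂ) {x y : ι} (h : x ≠ y) : ‖H x y‖ ^ 2 ≤ offSq H :=
  (Finset.single_le_sum (f := fun y => ‖H x y‖ ^ 2) (fun _ _ => by positivity)
    (Finset.mem_erase.mpr ⟨h.symm, Finset.mem_univ y⟩)).trans (row_le_offSq H x)

lemma sq_norm_le_frobSq (H : Matrix ι ι ℂ) (x y : ι) : ‖H x y‖ ^ 2 ≤ frobSq H :=
  (Finset.single_le_sum (f := fun y => ‖H x y‖ ^ 2) (fun _ _ => by positivity)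
    (Finset.mem_univ y)).trans
  (Finset.single_le_sum (f := fun x => ∑ y, ‖H x y‖ ^ 2)
    (fun _ _ => Finset.sum_nonneg fun _ _ => by positivity) (Finset.mem_univ x))

lemma offSq_eq_zero_iff : offSq H = 0 ↔ ∀ x y, x ≠ y → H x y = 0 := by
  constructor
  · intro h x y hxy
    have := sq_norm_le_offSq H hxy
    rw [h] at this
    exact norm_eq_zero.mp (pow_eq_zero_iff two_ne_zero |>.mp (le_antisymm this (by positivity)))
  · intro h
    refine Finset.sum_eq_zero fun x _ => Finset.sum_eq_zero fun y hy => ?_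
    rw [h x y (Finset.ne_of_mem_erase hy).symm]
    simp

lemma continuous_offSq : Continuous (offSq : Matrix ι ι ℂ → ℝ) := by
  unfold offSq
  fun_prop

lemma continuous_restrictTo : Continuous (restrictTo T : Matrix ι ι ℂ → Matrix ι ι ℂ) := by
  refine continuous_matrix fun x y => ?_
  simp only [restrictTo, of_apply]
  split_ifs <;> fun_prop

lemma ofReal_frobSq (H : Matrix ι ι ℂ) : (frobSq H : ℂ) = (Hᴴ * H).trace := by
  simp only [frobSq, trace, diag_apply, mul_apply, conjTranspose_apply]
  rw [Finset.sum_comm]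
  push_cast
  refine Finset.sum_congr rfl fun x _ => Finset.sum_congr rfl fun y _ => ?_
  exact (Complex.conj_mul' _).symm

lemma frobSq_conj (hU : Uᴴ * U = 1) (H : Matrix ι ι ℂ) : frobSq (Uᴴ * H * U) = frobSq H := by
  have hU' : U * Uᴴ = 1 := mul_eq_one_comm.mp hU
  apply Complex.ofReal_injective
  rw [ofReal_frobSq, ofReal_frobSq]
  have : (Uᴴ * H * U)ᴴ * (Uᴴ * H * U) = Uᴴ * (Hᴴ * H) * U := by
    simp only [conjTranspose_mul, conjTranspose_conjTranspose, mul_assoc]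
    rw [← mul_assoc U Uᴴ, hU', one_mul]
  rw [this, trace_mul_comm, ← mul_assoc, hU', one_mul]

lemma restrictTo_eq (H : Matrix ι ι ℂ) :
    restrictTo T H = diagonal (fun x => if T x then (1 : ℂ) else 0) * H *
      diagonal (fun x => if T x then (1 : ℂ) else 0) := by
  ext x y
  rw [mul_diagonal, diagonal_mul, restrictTo, of_apply]
  by_cases hx : T x <;> by_cases hy : T y <;> simp [hx, hy]

/-- `U` is the identity outside `T`, so it commutes with the coordinate projection onto `T`. -/
lemma restrictTo_conj (hE : ∀ x y, ¬(T x ∧ T y) → U x y = (1 : Matrix ι ι ℂ) x y)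
    (H : Matrix ι ι ℂ) : restrictTo T (Uᴴ * H * U) = Uᴴ * restrictTo T H * U := by
  set P : Matrix ι ι ℂ := diagonal (fun x => if T x then (1 : ℂ) else 0) with hP
  have hPU : P * U = U * P := by
    ext x y
    rw [hP, mul_diagonal, diagonal_mul]
    by_cases hx : T x <;> by_cases hy : T y <;> simp only [hx, hy, if_true, if_false, one_mul, mul_one, zero_mul, mul_zero]
    · rw [hE x y (by tauto), one_apply_ne (by rintro rfl; exact hy hx)]
    · rw [hE x y (by tauto), one_apply_ne (by rintro rfl; exact hx hy)]
  have hPP : Pᴴ = P := by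
    rw [hP, diagonal_conjTranspose]
    congr 1
    ext x
    by_cases hx : T x <;> simp [hx]
  have hPU' : Uᴴ * P = P * Uᴴ := by
    have := congrArg conjTranspose hPU
    rwa [conjTranspose_mul, conjTranspose_mul, hPP] at this
  rw [restrictTo_eq, restrictTo_eq, ← hP]
  calc P * (Uᴴ * H * U) * P = (P * Uᴴ) * H * (U * P) := by simp only [mul_assoc]
    _ = Uᴴ * (P * H * P) * U := by rw [← hPU', ← hPU]; simp only [mul_assoc]

/-- A unitary similarity that acts on the indices in `T` and diagonalizes the part of `H` with
indices in `T` reduces the off-norm by that of this part. -/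
lemma offSq_conj_add (hU : Uᴴ * U = 1)
    (hE : ∀ x y, ¬(T x ∧ T y) → U x y = (1 : Matrix ι ι ℂ) x y)
    (hd : ∀ x y, T x → T y → x ≠ y → (Uᴴ * H * U) x y = 0) :
    offSq (Uᴴ * H * U) + offSq (restrictTo T H) = offSq H := by
  have h1 := frobSq_conj hU H
  have h2 := frobSq_conj hU (restrictTo T H)
  rw [← restrictTo_conj hE] at h2
  have h3 : offSq (restrictTo T (Uᴴ * H * U)) = 0 := by
    rw [offSq_eq_zero_iff]
    intro x y hxy
    rw [restrictTo, of_apply]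
    split_ifs with h
    · exact hd x y h.1 h.2 hxy
    · rfl
  rw [frobSq_eq_diag_add_offSq, frobSq_eq_diag_add_offSq] at h1 h2
  -- Outside `T` the diagonal is unchanged, and inside `T` it equals that of the restriction. The
  -- diagonals therefore cancel when the two conserved Frobenius norms are subtracted.
  have h4 : ∑ x, (‖(Uᴴ * H * U) x x‖ ^ 2 - ‖restrictTo T (Uᴴ * H * U) x x‖ ^ 2) =
      ∑ x, (‖H x x‖ ^ 2 - ‖restrictTo T H x x‖ ^ 2) := by
    refine Finset.sum_congr rfl fun x _ => ?_
    by_cases hx : T x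
    · simp [restrictTo, hx]
    · have : (Uᴴ * H * U) x x = H x x := by
        rw [mul_apply, Finset.sum_eq_single x, hE x x (by tauto), one_apply_eq, mul_one,
          mul_apply, Finset.sum_eq_single x, conjTranspose_apply, hE x x (by tauto), one_apply_eq,
          star_one, one_mul]
        · intro z _ hz
          rw [conjTranspose_apply, hE z x (by tauto), one_apply_ne hz, star_zero, zero_mul]
        · simp
        · intro z _ hz
          rw [hE z x (by tauto), one_apply_ne hz, mul_zero]
        · simp
      simp [restrictTo, hx, this]
  rw [Finset.sum_sub_distrib, Finset.sum_sub_distrib] at h4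
  linarith

end OffNorm

/-! ### Convergence of the off-norm -/

section OffConvergence

variable {m : ℕ} {ι : Type*} [Fintype ι] [DecidableEq ι] {O : List (Fin m × Fin m)}
  {pivot : ℕ → Fin m × Fin m}

lemma IsCyclicStrategy.length_pos (h : IsCyclicStrategy O pivot) : 0 < O.length := by
  obtain ⟨h1, _⟩ := List.getElem?_eq_some_iff.mp (h 0)
  omega

lemma IsCyclicStrategy.getElem (h : IsCyclicStrategy O pivot) (n s : ℕ) (hs : s < O.length) :
    O[s] = pivot (n * O.length + s) := by
  have := h (n * O.length + s)
  rw [Nat.mul_add_mod_self_right, Nat.mod_eq_of_lt hs, List.getElem?_eq_getElem hs] at this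
  exact Option.some_injective _ this

lemma IsCyclicStrategy.add_mul (h : IsCyclicStrategy O pivot) (n s : ℕ) :
    pivot (n * O.length + s) = pivot s := by
  have h1 := h (n * O.length + s)
  rw [Nat.mul_add_mod_self_right, h s] at h1
  exact (Option.some_injective _ h1).symm

lemma IsCyclicStrategy.mem (h : IsCyclicStrategy O pivot) (k : ℕ) : pivot k ∈ O :=
  List.mem_of_getElem? (h k)

lemma exactChain_of_steps {b : ι → Fin m} (G : ℕ → Matrix ι ι ℂ) (L : List (Fin m × Fin m))
    (t : ℕ) (h : ∀ s (hs : s < L.length), ExactStep b (L[s]).1 (L[s]).2 (G (t + s)) (G (t + s + 1))) :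
    ExactChain b L (G t) (G (t + L.length)) := by
  induction L generalizing t with
  | nil => rfl
  | cons p L ih =>
    refine ⟨G (t + 1), h 0 (by simp), ?_⟩
    have := ih (t + 1) fun s hs => by
      have := h (s + 1) (by simpa using hs)
      simpa only [List.getElem_cons_succ, add_assoc, add_comm 1 s] using this
    simpa only [List.length_cons, add_assoc, add_comm 1] using this

lemma IsCyclicStrategy.exactChain {b : ι → Fin m} (h : IsCyclicStrategy O pivot)
    (G : ℕ → Matrix ι ι ℂ)
    (hG : ∀ s, ExactStep b (pivot s).1 (pivot s).2 (G s) (G (s + 1))) (N : ℕ) :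
    ExactChain b (List.replicate N O).flatten (G 0) (G (N * O.length)) := by
  induction N with
  | zero => simp [ExactChain]
  | succ N ih =>
    rw [List.replicate_succ', List.flatten_append, exactChain_append]
    refine ⟨_, ih, ?_⟩
    have := exactChain_of_steps (b := b) G O (N * O.length) fun s hs => by
      rw [h.getElem N s hs]
      exact hG _
    simpa [Nat.succ_mul] using this

lemma isHermitian_of_steps {H U : ℕ → Matrix ι ι ℂ} (hH : (H 0).IsHermitian)
    (hstep : ∀ k, H (k + 1) = (U k)ᴴ * H k * U k) (k : ℕ) : (H k).IsHermitian := by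
  induction k with
  | zero => exact hH
  | succ k ih => rw [hstep]; exact isHermitian_conjTranspose_mul_mul _ ih

lemma norm_apply_le_one_of_unitary {U : Matrix ι ι ℂ} (hU : Uᴴ * U = 1) (x y : ι) :
    ‖U x y‖ ≤ 1 := by
  have := congrFun (congrFun hU y) y
  rw [mul_apply, one_apply_eq] at this
  have h2 : (∑ z, ‖U z y‖ ^ 2 : ℝ) = 1 := by
    apply Complex.ofReal_injective
    push_cast
    rw [← this]
    exact Finset.sum_congr rfl fun z _ => (Complex.conj_mul' _).symm
  have h3 : ‖U x y‖ ^ 2 ≤ 1 := by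
    rw [← h2]
    exact Finset.single_le_sum (f := fun z => ‖U z y‖ ^ 2) (fun _ _ => by positivity)
      (Finset.mem_univ x)
  exact (sq_le_one_iff₀ (norm_nonneg _)).mp h3

/-- A countable product of compact balls is sequentially compact, so one subsequence serves all `s`
simultaneously. -/
lemma exists_subseq_of_bounded {κ : Type*} [Countable κ] (X : ℕ → κ → Matrix ι ι ℂ) (r : ℝ)
    (hX : ∀ n s x y, ‖X n s x y‖ ≤ r) :
    ∃ (φ : ℕ → ℕ) (G : κ → Matrix ι ι ℂ), StrictMono φ ∧
      ∀ s, Tendsto (fun n => X (φ n) s) atTop (𝓝 (G s)) := by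
  have hK : IsCompact (Set.univ.pi fun _ : κ => Set.univ.pi fun _ : ι => Set.univ.pi fun _ : ι =>
      Metric.closedBall (0 : ℂ) r) :=
    isCompact_univ_pi fun _ => isCompact_univ_pi fun _ => isCompact_univ_pi fun _ =>
      isCompact_closedBall _ _
  obtain ⟨G, _, φ, hφ, hlim⟩ := hK.tendsto_subseq (x := fun n s x y => X n s x y)
    (fun n s _ x _ y _ => by simpa using hX n s x y)
  refine ⟨φ, fun s => of (G s), hφ, fun s => ?_⟩
  exact tendsto_pi_nhds.mp hlim s

/-- The off-norm of a block Jacobi process with uniformly nonsingular diagonal blocks of the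
transformations tends to zero. -/
theorem tendsto_offSq_zero (hm : 2 ≤ m) (hO : IsOrdering O) (hF : ForcesBlockDiag ι O)
    (hpivot : IsCyclicStrategy O pivot) (b : ι → Fin m) (H U : ℕ → Matrix ι ι ℂ)
    (hH : (H 0).IsHermitian) (hstep : ∀ k, H (k + 1) = (U k)ᴴ * H k * U k)
    (hU : ∀ k, (U k)ᴴ * U k = 1)
    (hE : ∀ k, IsElementaryAt b (pivot k).1 (pivot k).2 (U k))
    (hdiag : ∀ k, PivotDiag b (pivot k).1 (pivot k).2 (H (k + 1)))
    (c : Fin m × Fin m → ℝ) (hc : ∀ p ∈ O, 0 < c p)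
    (hdet₁ : ∀ k, c (pivot k) ≤ ‖blockDet b (pivot k).1 (U k)‖)
    (hdet₂ : ∀ k, c (pivot k) ≤ ‖blockDet b (pivot k).2 (U k)‖) :
    Tendsto (fun k => offSq (H k)) atTop (𝓝 0) := by
  set M := O.length with hM
  have hMpos : 0 < M := hpivot.length_pos
  set R : ℕ → ℝ := fun k =>
    offSq (restrictTo (fun x => b x = (pivot k).1 ∨ b x = (pivot k).2) (H k)) with hR
  have hSR : ∀ k, offSq (H (k + 1)) + R k = offSq (H k) := fun k => by
    rw [hstep]
    refine offSq_conj_add (hU k) (hE k) fun x y hx hy hxy => ?_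
    rw [← hstep]
    exact hdiag k x y hx hy hxy
  have hanti : Antitone fun k => offSq (H k) := antitone_nat_of_succ_le fun k => by
    have := offSq_nonneg (restrictTo (fun x => b x = (pivot k).1 ∨ b x = (pivot k).2) (H k))
    have := hSR k
    linarith
  obtain ⟨L, hL⟩ : ∃ L, Tendsto (fun k => offSq (H k)) atTop (𝓝 L) :=
    ⟨_, tendsto_atTop_ciInf hanti ⟨0, by rintro _ ⟨k, rfl⟩; exact offSq_nonneg _⟩⟩
  have hRlim : Tendsto R atTop (𝓝 0) := by
    have h1 := hL.sub (hL.comp (tendsto_add_atTop_nat 1))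
    rw [sub_self] at h1
    refine h1.congr fun k => ?_
    have := hSR k
    simp only [Function.comp_apply]
    linarith
  have hfrob : ∀ k, frobSq (H k) = frobSq (H 0) := by
    intro k
    induction k with
    | zero => rfl
    | succ k ih => rw [hstep, frobSq_conj (hU k), ih]
  have hbound : ∀ k x y, ‖H k x y‖ ≤ √(frobSq (H 0)) + 1 := fun k x y => by
    have := Real.le_sqrt_of_sq_le ((sq_norm_le_frobSq (H k) x y).trans (hfrob k).le)
    linarith
  -- Along the cycles `φ n` the iterates and the transformations converge at every offset `s`. The
  -- radius covers both kinds of entries: those of `H` are at most `√(frobSq (H 0))`, those of `U`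
  -- at most 1.
  obtain ⟨φ, G, hφ, hGlim⟩ := exists_subseq_of_bounded
    (fun n (s : ℕ ⊕ ℕ) => Sum.elim (fun s => H (n * M + s)) (fun s => U (n * M + s)) s)
    (√(frobSq (H 0)) + 1) (by
      rintro n (s | s) x y
      · exact hbound _ x y
      · have := Real.sqrt_nonneg (frobSq (H 0))
        have := norm_apply_le_one_of_unitary (hU (n * M + s)) x y
        simp only [Sum.elim_inr]
        linarith)
  have hHlim : ∀ s, Tendsto (fun n => H (φ n * M + s)) atTop (𝓝 (G (Sum.inl s))) :=
    fun s => hGlim (Sum.inl s)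
  have hUlim : ∀ s, Tendsto (fun n => U (φ n * M + s)) atTop (𝓝 (G (Sum.inr s))) :=
    fun s => hGlim (Sum.inr s)
  have hsub : ∀ s, Tendsto (fun n => φ n * M + s) atTop atTop := fun s =>
    tendsto_atTop_mono (fun n => le_add_right (Nat.le_mul_of_pos_right _ hMpos)) hφ.tendsto_atTop
  have hpiv : ∀ n s, pivot (φ n * M + s) = pivot s := fun n s => hpivot.add_mul (φ n) s
  have hentry : ∀ {X : ℕ → Matrix ι ι ℂ} {Y : Matrix ι ι ℂ}, Tendsto X atTop (𝓝 Y) →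
      ∀ x y, Tendsto (fun n => X n x y) atTop (𝓝 (Y x y)) := fun h x y =>
    tendsto_pi_nhds.mp (tendsto_pi_nhds.mp h x) y
  have hdetc : ∀ i, Continuous (blockDet b i : Matrix ι ι ℂ → ℂ) := fun i => by
    unfold blockDet
    fun_prop
  have hdet : ∀ s i, (∀ n, c (pivot s) ≤ ‖blockDet b i (U (φ n * M + s))‖) →
      blockDet b i (G (Sum.inr s)) ≠ 0 := by
    intro s i h h0
    have h1 := ((hdetc i).norm.tendsto _).comp (hUlim s)
    have h2 := ge_of_tendsto' h1 h
    rw [h0, norm_zero] at h2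
    exact absurd h2 (not_le.mpr (hc _ (hpivot.mem s)))
  -- The pivot at offset `s` is the same in all cycles and the conditions on a step are closed,
  -- given the uniform bounds on the determinants. Diagonality before the step comes from `R → 0`.
  have hexact : ∀ s, ExactStep b (pivot s).1 (pivot s).2 (G (Sum.inl s)) (G (Sum.inl (s + 1))) := by
    intro s
    refine ⟨G (Sum.inr s), ?_, ?_, ?_, ?_, ?_, ?_, ?_, ?_⟩
    · have hcont : Continuous fun X : Matrix ι ι ℂ => Xᴴ * X := by fun_prop
      refine tendsto_nhds_unique ((hcont.tendsto _).comp (hUlim s)) ?_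
      exact tendsto_const_nhds.congr fun n => (hU _).symm
    · intro x y hxy
      refine tendsto_nhds_unique (hentry (hUlim s) x y) ?_
      refine tendsto_const_nhds.congr fun n => ?_
      exact (hE (φ n * M + s) x y (by rwa [hpiv])).symm
    · exact hdet s _ fun n => by
        have := hdet₁ (φ n * M + s)
        rwa [hpiv] at this
    · exact hdet s _ fun n => by
        have := hdet₂ (φ n * M + s)
        rwa [hpiv] at this
    · have hcont : Continuous fun X : Matrix ι ι ℂ => Xᴴ := by fun_prop
      refine tendsto_nhds_unique ((hcont.tendsto _).comp (hHlim s)) ?_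
      exact (hHlim s).congr fun n => (isHermitian_of_steps hH hstep _).symm
    · have hcont : Continuous fun X : Matrix ι ι ℂ × Matrix ι ι ℂ => X.2ᴴ * X.1 * X.2 := by
        fun_prop
      refine tendsto_nhds_unique (hHlim (s + 1))
        (((hcont.tendsto _).comp ((hHlim s).prodMk_nhds (hUlim s))).congr fun n => ?_)
      exact (hstep (φ n * M + s)).symm
    · have h1 := ((continuous_offSq.comp (continuous_restrictTo
        (T := fun x => b x = (pivot s).1 ∨ b x = (pivot s).2))).tendsto _).comp (hHlim s)
      have h2 := tendsto_nhds_unique h1 ((hRlim.comp (hsub s)).congr fun n => by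
        have e := hpiv n s
        simp only [hR, Function.comp_apply]
        generalize pivot (φ n * M + s) = p at e ⊢
        subst e
        rfl)
      intro x y hx hy hxy
      have := offSq_eq_zero_iff.mp h2 x y hxy
      simpa [restrictTo, hx, hy] using this
    · intro x y hx hy hxy
      refine tendsto_nhds_unique (hentry (hHlim (s + 1)) x y) ?_
      refine tendsto_const_nhds.congr fun n => ?_
      exact (hdiag (φ n * M + s) x y (by rwa [hpiv]) (by rwa [hpiv]) hxy).symm
  have hoff : ∀ s, offSq (G (Sum.inl s)) = L := fun s =>
    tendsto_nhds_unique ((continuous_offSq.tendsto _).comp (hHlim s)) (hL.comp (hsub s))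
  obtain ⟨N, hN⟩ := hF
  -- `N` cycles force block diagonality; the additional one ensures that every block takes part in a
  -- pivot even when `N = 0`, which makes the diagonal blocks diagonal.
  have hchain := hpivot.exactChain (b := b) (fun s => G (Sum.inl s)) hexact (N + 1)
  have hzero : OffBlockZero b (G (Sum.inl ((N + 1) * O.length))) := by
    rw [List.replicate_succ, List.flatten_cons, exactChain_append] at hchain
    obtain ⟨G', _, h2⟩ := hchain
    exact hN b _ _ h2
  have hL0 : L = 0 := by
    rw [← hoff ((N + 1) * O.length), offSq_eq_zero_iff]
    intro x y hxy
    by_cases hb : b x = b y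
    · refine hchain.diagBlock (s := b y) (Or.inr ?_) x y hb rfl hxy
      have hmem : ∀ p ∈ O, p ∈ (List.replicate (N + 1) O).flatten := fun p hp => by
        rw [List.replicate_succ, List.flatten_cons]
        exact List.mem_append_left _ hp
      -- As `m ≥ 2`, block 0 occurs in the pair (0, 1) and every other block `r` in (0, r).
      by_cases h0 : (b y : ℕ) = 0
      · exact ⟨(b y, ⟨1, by omega⟩), hmem _ ((hO.2 _).mpr (by simp [Fin.lt_def, h0])), Or.inl rfl⟩
      · exact ⟨(⟨0, by omega⟩, b y), hmem _ ((hO.2 _).mpr (by simp [Fin.lt_def]; omega)),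
          Or.inr rfl⟩
    · exact hzero x y hb
  rwa [hL0] at hL

end OffConvergence

/-! ### Jacobi rotations -/

section Rotation

variable {ι : Type*} [Fintype ι] [DecidableEq ι] {H R : Matrix ι ι ℂ} {p q : ι}

lemma conj_apply_of_pair (hpq : p ≠ q)
    (hR : ∀ x y, ¬((x = p ∨ x = q) ∧ (y = p ∨ y = q)) → R x y = (1 : Matrix ι ι ℂ) x y)
    (H : Matrix ι ι ℂ) {x y : ι} (hx : x = p ∨ x = q) (hy : y = p ∨ y = q) :
    (Rᴴ * H * R) x y =
      (star (R p x) * H p p + star (R q x) * H q p) * R p y +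
      (star (R p x) * H p q + star (R q x) * H q q) * R q y := by
  have hcol : ∀ z y, (y = p ∨ y = q) → (z ≠ p ∧ z ≠ q) → R z y = 0 := by
    intro z y hy hz
    rw [hR z y (by tauto), one_apply_ne]
    rintro rfl
    tauto
  have hleft : ∀ z, (Rᴴ * H) x z = star (R p x) * H p z + star (R q x) * H q z := by
    intro z
    rw [mul_apply, Fintype.sum_eq_add p q hpq]
    · simp only [conjTranspose_apply]
    · intro w hw
      rw [conjTranspose_apply, hcol w x hx hw, star_zero, zero_mul]
  rw [mul_apply, Fintype.sum_eq_add p q hpq, hleft, hleft]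
  intro w hw
  rw [hcol w y hy hw, mul_zero]

/-- Entries of a Jacobi rotation and of the pivot submatrix in real parameters. -/
lemma IsJacobiRotation.parameters (h : IsJacobiRotation H p q R) (hH : H.IsHermitian) :
    ∃ (e : ℂ) (c s a d t : ℝ), e * star e = 1 ∧ c ^ 2 + s ^ 2 = 1 ∧ 0 < c ∧ |s| ≤ c ∧
      (a - d) * (s * c) = t * (c ^ 2 - s ^ 2) ∧ ‖H p q‖ = t ∧
      R p p = c ∧ R p q = -(e * s) ∧ R q p = star e * s ∧ R q q = c ∧
      H p p = a ∧ H q q = d ∧ H p q = t * e ∧ H q p = t * star e := by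
  obtain ⟨φ, h1, h2, h3, -, h5, h6, h7, h8, -⟩ := h
  have hpi := Real.pi_pos
  have hc : 0 < Real.cos φ := Real.cos_pos_of_mem_Ioo ⟨by linarith, by linarith⟩
  have hc2 : 0 ≤ Real.cos (2 * φ) :=
    Real.cos_nonneg_of_mem_Icc ⟨by linarith, by linarith⟩
  have hpyth := Real.cos_sq_add_sin_sq φ
  have hstar : star (Complex.exp ((H p q).arg * Complex.I)) =
      Complex.exp (-((H p q).arg * Complex.I)) := by
    rw [Complex.star_def, ← Complex.exp_conj]
    simp
  have hdiag : ∀ x, H x x = ((H x x).re : ℂ) := fun x => (hH.coe_re_apply_self x).symm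
  have hpq : H p q = (‖H p q‖ : ℂ) * Complex.exp ((H p q).arg * Complex.I) :=
    (Complex.norm_mul_exp_arg_mul_I _).symm
  refine ⟨Complex.exp ((H p q).arg * Complex.I), Real.cos φ, Real.sin φ, (H p p).re, (H q q).re,
    ‖H p q‖, ?_, hpyth, hc, ?_, ?_, rfl, h5, h6, ?_, h8, hdiag p, hdiag q, hpq, ?_⟩
  · rw [hstar, ← Complex.exp_add, add_neg_cancel, Complex.exp_zero]
  -- For `|φ| ≤ π/4`, `cos 2φ ≥ 0` says that `sin² φ ≤ cos² φ`.
  · apply abs_le_of_sq_le_sq _ hc.le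
    rw [Real.cos_two_mul] at hc2
    linarith
  · rw [Real.sin_two_mul, Real.cos_two_mul'] at h3
    linarith
  · rw [h7, hstar]
  · rw [← hH.apply, hpq, star_mul', Complex.star_def, Complex.conj_ofReal, ← hpq]

lemma IsJacobiRotation.elementary (h : IsJacobiRotation H p q R) :
    ∀ x y, ¬((x = p ∨ x = q) ∧ (y = p ∨ y = q)) → R x y = (1 : Matrix ι ι ℂ) x y := by
  obtain ⟨φ, -, -, -, -, -, -, -, -, h⟩ := h
  exact h

lemma IsJacobiRotation.conjTranspose_mul_self (h : IsJacobiRotation H p q R) (hpq : p ≠ q)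
    (hH : H.IsHermitian) : Rᴴ * R = 1 := by
  obtain ⟨e, c, s, a, d, t, he, hcs, hc, hsc, hrel, ht, r1, r2, r3, r4, -⟩ := h.parameters hH
  have hcs' : (c : ℂ) ^ 2 + (s : ℂ) ^ 2 = 1 := by exact_mod_cast hcs
  have hE := h.elementary
  have happ : ∀ x y, (x = p ∨ x = q) → (y = p ∨ y = q) →
      (Rᴴ * R) x y = star (R p x) * R p y + star (R q x) * R q y := by
    intro x y hx hy
    have := conj_apply_of_pair hpq hE 1 hx hy
    rw [mul_one] at this
    simpa [hpq, hpq.symm] using this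
  ext x y
  by_cases hx : x = p ∨ x = q
  · by_cases hy : y = p ∨ y = q
    · rw [happ x y hx hy]
      rcases hx with rfl | rfl <;> rcases hy with rfl | rfl
      · rw [r1, r3, one_apply_eq]
        simp only [star_mul', Complex.star_def, Complex.conj_ofReal, Complex.conj_conj] at he ⊢
        linear_combination hcs' + s ^ 2 * he
      · rw [r1, r2, r3, r4, one_apply_ne hpq]
        simp only [star_mul', Complex.star_def, Complex.conj_ofReal, Complex.conj_conj]
        ring
      · rw [r1, r2, r3, r4, one_apply_ne hpq.symm]
        simp only [star_neg, star_mul', Complex.star_def, Complex.conj_ofReal]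
        ring
      · rw [r2, r4, one_apply_eq]
        simp only [star_neg, star_mul', Complex.star_def, Complex.conj_ofReal] at he ⊢
        linear_combination hcs' + s ^ 2 * he
    · rw [mul_apply, Finset.sum_eq_single y]
      · rw [hE y y (by tauto), one_apply_eq, mul_one, conjTranspose_apply, hE y x (by tauto)]
        simp [one_apply, eq_comm]
      · intro z _ hz
        rw [hE z y (by tauto), one_apply_ne hz, mul_zero]
      · simp
  · rw [mul_apply, Finset.sum_eq_single x]
    · rw [conjTranspose_apply, hE x x (by tauto), one_apply_eq, star_one, one_mul,
        hE x y (by tauto)]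
    · intro z _ hz
      rw [conjTranspose_apply, hE z x (by tauto), one_apply_ne hz, star_zero, zero_mul]
    · simp

lemma IsJacobiRotation.conj_apply_eq_zero (h : IsJacobiRotation H p q R) (hpq : p ≠ q)
    (hH : H.IsHermitian) : (Rᴴ * H * R) p q = 0 := by
  obtain ⟨e, c, s, a, d, t, he, hcs, hc, hsc, hrel, ht, r1, r2, r3, r4, k1, k2, k3, k4⟩ :=
    h.parameters hH
  have hrel' : ((a : ℂ) - d) * (s * c) = t * (c ^ 2 - s ^ 2) := by exact_mod_cast hrel
  rw [conj_apply_of_pair hpq h.elementary H (Or.inl rfl) (Or.inr rfl), r1, r2, r3, r4, k1, k2, k3,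
    k4]
  simp only [star_mul', Complex.star_def, Complex.conj_ofReal, Complex.conj_conj] at he ⊢
  linear_combination (-e) * hrel' - e * t * s ^ 2 * he

/-- A Jacobi rotation with angle in `[-π/4, π/4]` changes the diagonal entries by at most the
modulus of the pivot entry. -/
lemma IsJacobiRotation.norm_conj_diag_sub_le (h : IsJacobiRotation H p q R) (hpq : p ≠ q)
    (hH : H.IsHermitian) (x : ι) : ‖(Rᴴ * H * R) x x - H x x‖ ≤ ‖H p q‖ := by
  have hE := h.elementary
  obtain ⟨e, c, s, a, d, t, he, hcs, hc, hsc, hrel, ht, r1, r2, r3, r4, k1, k2, k3, k4⟩ :=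
    h.parameters hH
  have ht0 : 0 ≤ t := ht ▸ norm_nonneg _
  have hcs' : (c : ℂ) ^ 2 + (s : ℂ) ^ 2 = 1 := by exact_mod_cast hcs
  -- By the angle equation the change of the diagonal entry is `t tan φ`, and `|tan φ| ≤ 1`.
  have hΔ : |s ^ 2 * (d - a) + 2 * c * s * t| ≤ t := by
    have h1 : c * (s ^ 2 * (d - a) + 2 * c * s * t) = s * t := by
      linear_combination (-s) * hrel + s * t * hcs
    have h2 : c * |s ^ 2 * (d - a) + 2 * c * s * t| ≤ c * t := by
      rw [← abs_of_pos hc, ← abs_mul, abs_of_pos hc, h1, abs_mul, abs_of_nonneg ht0]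
      exact mul_le_mul_of_nonneg_right hsc ht0
    exact le_of_mul_le_mul_left h2 hc
  rw [ht]
  by_cases hx : x = p ∨ x = q
  · rw [conj_apply_of_pair hpq hE H hx hx]
    rcases hx with rfl | rfl
    · rw [r1, r3, k1, k2, k3, k4]
      refine le_of_eq_of_le ?_ hΔ
      rw [← Real.norm_eq_abs, ← Complex.norm_real]
      congr 1
      push_cast
      simp only [star_mul', Complex.star_def, Complex.conj_ofReal, Complex.conj_conj] at he ⊢
      linear_combination a * hcs' + (2 * c * s * t + s ^ 2 * d) * he
    · rw [r2, r4, k1, k2, k3, k4]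
      refine le_of_eq_of_le ?_ hΔ
      rw [← Real.norm_eq_abs, ← Complex.norm_real, ← norm_neg]
      congr 1
      push_cast
      simp only [star_neg, star_mul', Complex.star_def, Complex.conj_ofReal] at he ⊢
      linear_combination (-d) * hcs' + (2 * c * s * t - s ^ 2 * a) * he
  · have : (Rᴴ * H * R) x x = H x x := by
      rw [mul_apply, Finset.sum_eq_single x, hE x x (by tauto), one_apply_eq, mul_one,
        mul_apply, Finset.sum_eq_single x, conjTranspose_apply, hE x x (by tauto), one_apply_eq,
        star_one, one_mul]
      · intro z _ hz
        rw [conjTranspose_apply, hE z x (by tauto), one_apply_ne hz, star_zero, zero_mul]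
      · simp
      · intro z _ hz
        rw [hE z x (by tauto), one_apply_ne hz, mul_zero]
      · simp
    rw [this, sub_self, norm_zero]
    exact ht0

lemma IsJacobiRotation.offSq_conj_le (h : IsJacobiRotation H p q R) (hpq : p ≠ q)
    (hH : H.IsHermitian) : offSq (Rᴴ * H * R) ≤ offSq H := by
  have h0 := h.conj_apply_eq_zero hpq hH
  have h1 := offSq_conj_add (T := fun x => x = p ∨ x = q) (h.conjTranspose_mul_self hpq hH)
    h.elementary (H := H) (by
      rintro x y (rfl | rfl) (rfl | rfl) hxy
      · exact absurd rfl hxy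
      · exact h0
      · rw [← (isHermitian_conjTranspose_mul_mul R hH).apply, h0, star_zero]
      · exact absurd rfl hxy)
  have := offSq_nonneg (restrictTo (fun x => x = p ∨ x = q) H)
  linarith

end Rotation

/-! ### Jacobi methods for nearly diagonal matrices -/

section NearlyDiagonal

variable {ι : Type*} [Fintype ι] [DecidableEq ι]

lemma sum_norm_sq_mulVec {κ : Type*} [Fintype κ] {V : Matrix κ ι ℂ} (hV : Vᴴ * V = 1)
    (u : ι → ℂ) : ∑ y, ‖(V *ᵥ u) y‖ ^ 2 = ∑ y, ‖u y‖ ^ 2 := by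
  have key : ∀ {κ : Type _} [Fintype κ] (v : κ → ℂ),
      ((∑ y, ‖v y‖ ^ 2 : ℝ) : ℂ) = star v ⬝ᵥ v := by
    intro κ _ v
    push_cast
    exact Finset.sum_congr rfl fun z _ => (Complex.conj_mul' _).symm
  have key' : ((∑ y, ‖(V *ᵥ u) y‖ ^ 2 : ℝ) : ℂ) = star (V *ᵥ u) ⬝ᵥ (V *ᵥ u) := by
    push_cast
    exact Finset.sum_congr rfl fun z _ => (Complex.conj_mul' _).symm
  apply Complex.ofReal_injective
  rw [key', key, star_mulVec, dotProduct_mulVec, vecMul_vecMul, hV, vecMul_one]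

lemma sum_norm_sq_vecMul {V : Matrix ι ι ℂ} (hV : V * Vᴴ = 1)
    (u : ι → ℂ) : ∑ y, ‖(u ᵥ* V) y‖ ^ 2 = ∑ y, ‖u y‖ ^ 2 := by
  have h := sum_norm_sq_mulVec (V := Vᵀ) (by
    rw [show Vᵀᴴ = Vᴴᵀ from rfl, ← transpose_mul, hV, transpose_one]) u
  rwa [mulVec_transpose] at h

lemma sum_norm_sq_row {κ μ : Type*} [Fintype κ] [DecidableEq μ] {V : Matrix μ κ ℂ}
    (hV : V * Vᴴ = 1) (x : μ) : ∑ y, ‖V x y‖ ^ 2 = 1 := by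
  apply Complex.ofReal_injective
  have := congrFun (congrFun hV x) x
  rw [one_apply_eq, mul_apply] at this
  push_cast
  rw [← this]
  exact Finset.sum_congr rfl fun z _ => (Complex.mul_conj' _).symm

/-- Row `x` of `G - G_{xx}` has norm at most `ε`. Multiplied by the unitary `V` it has entries
`V_{xy} (λ_y - G_{xx})`, and since row `x` of `V` is a unit vector, not all factors can exceed `ε`
in modulus. -/
lemma exists_eigenvalue_near_diag {G V : Matrix ι ι ℂ} {lam : ι → ℂ} (hV : Vᴴ * V = 1)
    (hG : G * V = V * diagonal lam) {ε : ℝ} (hε : 0 ≤ ε) (hoff : offSq G ≤ ε ^ 2) (x : ι) :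
    ∃ y, ‖lam y - G x x‖ ≤ ε := by
  have hV' : V * Vᴴ = 1 := mul_eq_one_comm.mp hV
  by_contra! hcon
  set D : Matrix ι ι ℂ := G - diagonal fun _ => G x x with hD
  have h1 : ∀ y, (D x ᵥ* V) y = V x y * (lam y - G x x) := by
    intro y
    have e := congrFun (congrFun hG x) y
    rw [mul_diagonal] at e
    have e' : (D x ᵥ* V) y = (D * V) x y := rfl
    rw [e', hD, sub_mul, Matrix.sub_apply, e, diagonal_mul]
    ring
  have h2 := sum_norm_sq_vecMul hV' (D x)
  have h3 : ∑ z, ‖D x z‖ ^ 2 ≤ ε ^ 2 := by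
    refine le_trans (le_of_eq ?_) ((row_le_offSq G x).trans hoff)
    rw [← Finset.add_sum_erase _ _ (Finset.mem_univ x)]
    simp only [hD, Matrix.sub_apply, diagonal_apply_eq, sub_self, norm_zero]
    rw [zero_pow two_ne_zero, zero_add]
    refine Finset.sum_congr rfl fun z hz => ?_
    rw [diagonal_apply_ne _ (Finset.ne_of_mem_erase hz).symm, sub_zero]
  have h4 : ε ^ 2 < ∑ y, ‖(D x ᵥ* V) y‖ ^ 2 := by
    have h5 := sum_norm_sq_row hV' x
    calc ε ^ 2 = ∑ y, ‖V x y‖ ^ 2 * ε ^ 2 := by rw [← Finset.sum_mul, h5, one_mul]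
      _ < _ := by
        obtain ⟨y, hy⟩ : ∃ y, V x y ≠ 0 := by
          by_contra! h0
          simp [h0] at h5
        refine Finset.sum_lt_sum (fun y _ => ?_) ⟨y, Finset.mem_univ y, ?_⟩
        · rw [h1, norm_mul, mul_pow]
          have := (hcon y).le
          gcongr
        · rw [h1, norm_mul, mul_pow]
          have := hcon y
          have := norm_pos_iff.mpr hy
          gcongr
  linarith

/-! ### Iterates and outputs of an element-wise method. -/

variable {J : JacobiMethod ι} {H W : Matrix ι ι ℂ}

lemma JacobiMethod.iter_zero (J : JacobiMethod ι) (H : Matrix ι ι ℂ) : J.iter H 0 = H := by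
  simp [JacobiMethod.iter, rotProd]

lemma JacobiMethod.iter_succ (J : JacobiMethod ι) (H : Matrix ι ι ℂ) (l : ℕ) :
    J.iter H (l + 1) = (J.rot H l)ᴴ * J.iter H l * J.rot H l := by
  simp only [JacobiMethod.iter, rotProd, conjTranspose_mul, mul_assoc]

lemma JacobiMethod.iter_isHermitian (hH : H.IsHermitian) (l : ℕ) : (J.iter H l).IsHermitian :=
  isHermitian_conjTranspose_mul_mul _ hH

lemma JacobiMethod.rotProd_unitary (hH : H.IsHermitian) (l : ℕ) :
    (rotProd (J.rot H) l)ᴴ * rotProd (J.rot H) l = 1 := by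
  induction l with
  | zero => simp [rotProd]
  | succ l ih =>
    obtain ⟨p, q, hpq, h⟩ := J.isRotation H hH l
    have h1 := h.conjTranspose_mul_self hpq (J.iter_isHermitian hH l)
    rw [rotProd, conjTranspose_mul, mul_assoc, ← mul_assoc (rotProd (J.rot H) l)ᴴ, ih, one_mul, h1]

lemma JacobiMethod.offSq_iter_le (hH : H.IsHermitian) (l : ℕ) :
    offSq (J.iter H l) ≤ offSq H := by
  induction l with
  | zero => rw [J.iter_zero]
  | succ l ih =>
    obtain ⟨p, q, hpq, h⟩ := J.isRotation H hH l
    rw [J.iter_succ]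
    exact (h.offSq_conj_le hpq (J.iter_isHermitian hH l)).trans ih

lemma JacobiMethod.IsOutput.exists_subseq (hW : J.IsOutput H W) :
    ∃ φ : ℕ → ℕ, StrictMono φ ∧ Tendsto (fun n => rotProd (J.rot H) (φ n)) atTop (𝓝 W) := by
  have : FirstCountableTopology (Matrix ι ι ℂ) :=
    inferInstanceAs (FirstCountableTopology (ι → ι → ℂ))
  exact MapClusterPt.tendsto_subseq hW

lemma JacobiMethod.IsOutput.unitary (hW : J.IsOutput H W) (hH : H.IsHermitian) : Wᴴ * W = 1 := by
  obtain ⟨φ, _, hφ⟩ := hW.exists_subseq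
  have hcont : Continuous fun X : Matrix ι ι ℂ => Xᴴ * X := by fun_prop
  refine tendsto_nhds_unique ((hcont.tendsto _).comp hφ) ?_
  exact tendsto_const_nhds.congr fun n => (J.rotProd_unitary hH _).symm

/-- For a nearly diagonal matrix with separated eigenvalues, a Jacobi method does not permute the
diagonal entries. -/
lemma JacobiMethod.IsOutput.norm_diag_sub_le (hW : J.IsOutput H W) (hH : H.IsHermitian)
    {lam : ι → ℂ} (hd : Wᴴ * H * W = diagonal lam) {ε δ : ℝ} (hε : 0 ≤ ε) (hεδ : 4 * ε < δ)
    (hoff : offSq H ≤ ε ^ 2) (hsep : ∀ x y, x ≠ y → δ ≤ ‖lam x - lam y‖) (x : ι) :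
    ‖H x x - lam x‖ ≤ ε := by
  have hWu := hW.unitary hH
  have hWu' : W * Wᴴ = 1 := mul_eq_one_comm.mp hWu
  have hoffl : ∀ l, offSq (J.iter H l) ≤ ε ^ 2 := fun l => (J.offSq_iter_le hH l).trans hoff
  have hnear : ∀ l, ∃ y, ‖lam y - J.iter H l x x‖ ≤ ε := by
    intro l
    set Q := rotProd (J.rot H) l with hQ
    have hQu : Qᴴ * Q = 1 := J.rotProd_unitary hH l
    have hQu' : Q * Qᴴ = 1 := mul_eq_one_comm.mp hQu
    refine exists_eigenvalue_near_diag (V := Qᴴ * W) ?_ ?_ hε (hoffl l) x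
    · rw [conjTranspose_mul, conjTranspose_conjTranspose, mul_assoc, ← mul_assoc Q, hQu', one_mul,
        hWu]
    · rw [← hd]
      calc Qᴴ * H * Q * (Qᴴ * W) = Qᴴ * H * (Q * Qᴴ) * W := by simp only [mul_assoc]
        _ = Qᴴ * (W * Wᴴ) * H * W := by rw [hQu', hWu']; simp only [mul_one]
        _ = Qᴴ * W * (Wᴴ * H * W) := by simp only [mul_assoc]
  obtain ⟨y, hy⟩ := hnear 0
  -- No jumps: a rotation moves the entry by at most `ε`, so the eigenvalues near it before and
  -- after differ by at most `3ε < δ` and coincide.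
  have hall : ∀ l, ‖lam y - J.iter H l x x‖ ≤ ε := by
    intro l
    induction l with
    | zero => exact hy
    | succ l ih =>
      obtain ⟨y', hy'⟩ := hnear (l + 1)
      obtain ⟨p, q, hpq, h⟩ := J.isRotation H hH l
      have h1 := h.norm_conj_diag_sub_le hpq (J.iter_isHermitian hH l) x
      have h2 : ‖J.iter H l p q‖ ≤ ε :=
        le_of_sq_le_sq ((sq_norm_le_offSq _ hpq).trans (hoffl l)) hε
      have h3 : ‖J.iter H (l + 1) x x - J.iter H l x x‖ ≤ ε := by
        rw [J.iter_succ]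
        exact h1.trans h2
      have h4 : y' = y := by
        by_contra hne
        have h5 := hsep y' y hne
        have h6 : ‖lam y' - lam y‖ ≤ ε + ε + ε := by
          have e : lam y' - lam y = (lam y' - J.iter H (l + 1) x x) +
              (J.iter H (l + 1) x x - J.iter H l x x) - (lam y - J.iter H l x x) := by ring
          rw [e]
          refine (norm_sub_le _ _).trans ?_
          have := norm_add_le (lam y' - J.iter H (l + 1) x x)
            (J.iter H (l + 1) x x - J.iter H l x x)
          linarith
        linarith
      exact h4 ▸ hy'
  -- Along the subsequence defining `W`, the entry tends to `λ_x`, which identifies the eigenvalue.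
  have hyx : y = x := by
    by_contra hne
    obtain ⟨φ, _, hφ⟩ := hW.exists_subseq
    have hcont : Continuous fun X : Matrix ι ι ℂ => ‖lam y - (Xᴴ * H * X) x x‖ := by
      fun_prop
    have h1 := le_of_tendsto' ((hcont.tendsto _).comp hφ) (fun n => hall (φ n))
    rw [hd, diagonal_apply_eq] at h1
    have := hsep y x hne
    linarith
  have := hall 0
  rwa [J.iter_zero, hyx, norm_sub_rev] at this

/-- The eigenvector matrix of a nearly diagonal matrix with separated eigenvalues is nearly
diagonal. -/
lemma norm_eigenvector_le (hW : Wᴴ * W = 1) {lam : ι → ℂ} (hd : Wᴴ * H * W = diagonal lam)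
    {ε δ : ℝ} (hε : 0 ≤ ε) (hoff : offSq H ≤ ε ^ 2)
    (hsep : ∀ x y, x ≠ y → δ ≤ ‖lam x - lam y‖) (hnear : ∀ x, ‖H x x - lam x‖ ≤ ε)
    {x y : ι} (hxy : x ≠ y) : (δ - ε) * ‖W x y‖ ≤ ε := by
  have hW' : W * Wᴴ = 1 := mul_eq_one_comm.mp hW
  have hHW : H * W = W * diagonal lam := by
    rw [← hd, ← mul_assoc, ← mul_assoc, hW', one_mul]
  have e := congrFun (congrFun hHW x) y
  rw [mul_diagonal, mul_apply, ← Finset.add_sum_erase _ _ (Finset.mem_univ x)] at e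
  -- This is entry `(x, y)` of `H W = W Λ` with the diagonal term moved over. The sum is at most `ε`
  -- by Cauchy–Schwarz, column `y` of `W` being a unit vector, while the factor on the left is at
  -- least `δ - ε`.
  have e1 : (lam y - H x x) * W x y = ∑ z ∈ Finset.univ.erase x, H x z * W z y := by
    linear_combination -e
  have hcol : ∑ z, ‖W z y‖ ^ 2 = 1 := by
    have := sum_norm_sq_row (V := Wᴴ) (by simpa using hW) y
    simpa using this
  have h1 : ‖∑ z ∈ Finset.univ.erase x, H x z * W z y‖ ≤ ε := by
    refine (norm_sum_le _ _).trans ?_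
    simp only [norm_mul]
    apply le_of_sq_le_sq _ hε
    refine (Finset.sum_mul_sq_le_sq_mul_sq _ _ _).trans ?_
    have h2 : ∑ z ∈ Finset.univ.erase x, ‖W z y‖ ^ 2 ≤ 1 := by
      rw [← hcol]
      exact Finset.sum_le_sum_of_subset_of_nonneg (Finset.subset_univ _) fun _ _ _ => by positivity
    calc _ ≤ ε ^ 2 * 1 := by
          refine mul_le_mul ((row_le_offSq H x).trans hoff) h2 ?_ (by positivity)
          exact Finset.sum_nonneg fun _ _ => by positivity
      _ = ε ^ 2 := mul_one _
  have h3 : δ - ε ≤ ‖lam y - H x x‖ := by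
    have h4 := hsep x y hxy
    have h5 : ‖lam x - lam y‖ ≤ ‖lam y - H x x‖ + ‖H x x - lam x‖ := by
      rw [norm_sub_rev]
      exact norm_sub_le_norm_sub_add_norm_sub _ _ _
    have := hnear x
    linarith
  calc (δ - ε) * ‖W x y‖ ≤ ‖lam y - H x x‖ * ‖W x y‖ := by gcongr
    _ = ‖∑ z ∈ Finset.univ.erase x, H x z * W z y‖ := by rw [← norm_mul, e1]
    _ ≤ ε := h1

end NearlyDiagonal

/-! ### QR with column pivoting of a nearly diagonal block row -/

section PivotedQR

variable {p q : ℕ} {Y : Matrix (Fin p) (Fin p ⊕ Fin q) ℂ} {c : Fin p → Fin p ⊕ Fin q}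

/-- If the rows of `Y` are orthonormal and its last `q` columns are small, then QR with column
pivoting interchanges the first `p` columns only. -/
lemma IsPivotedQR.isLeft (h : IsPivotedQR Y c) (hY : Y * Yᴴ = 1)
    (hsmall : ∀ t : Fin q, ((p : ℝ) + q) * ∑ a, ‖Y a (Sum.inr t)‖ ^ 2 < 1) (r : Fin p) :
    (c r).isLeft := by
  obtain ⟨Z, Q, hZ0, hZ⟩ := h
  -- Invariants of the run while no column of the second part is chosen: orthonormal rows, unchanged
  -- norms of the last `q` columns, and zeros below the diagonal in the processed columns.
  have main : ∀ k : ℕ, k ≤ p → (∀ s : Fin p, (s : ℕ) < k → (c s).isLeft) ∧ Z k * (Z k)ᴴ = 1 ∧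
      (∀ t, ∑ a, ‖Z k a (Sum.inr t)‖ ^ 2 = ∑ a, ‖Y a (Sum.inr t)‖ ^ 2) ∧
      ∀ s : Fin p, (s : ℕ) < k → ∀ a, s < a → Z k a (Sum.inl s) = 0 := by
    intro k hk
    induction k with
    | zero => exact ⟨by simp, by rw [hZ0, hY], by simp [hZ0], by simp⟩
    | succ k ih =>
      obtain ⟨ih1, ih2, ih3, ih4⟩ := ih (by omega)
      set r : Fin p := ⟨k, hk⟩ with hr
      obtain ⟨z1, z2, z3, z4, z5, z6⟩ := hZ r
      -- If column `t` of the second part were chosen, its norm would bound every entry of row `r`,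
      -- the entries in processed columns being zero. The unit norm of the row would then give `1 ≤
      -- (p + q) ‖Y_t‖²`, against `hsmall`.
      have hleft : (c r).isLeft := by
        rcases hcr : c r with s | t
        · rfl
        exfalso
        have hrow := sum_norm_sq_row ih2 r
        have hle : ∀ u, ‖Z k r u‖ ^ 2 ≤ ∑ a, ‖Y a (Sum.inr t)‖ ^ 2 := by
          intro u
          by_cases hu : ∀ s, u = Sum.inl s → r ≤ s
          · calc ‖Z k r u‖ ^ 2 ≤ ∑ a ∈ Finset.Ici r, ‖Z k a u‖ ^ 2 :=
                  Finset.single_le_sum (f := fun a => ‖Z k a u‖ ^ 2) (fun _ _ => by positivity)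
                    (Finset.mem_Ici.mpr le_rfl)
              _ ≤ ∑ a ∈ Finset.Ici r, ‖Z k a (c r)‖ ^ 2 := z2 u hu
              _ ≤ ∑ a, ‖Z k a (c r)‖ ^ 2 :=
                  Finset.sum_le_sum_of_subset_of_nonneg (Finset.subset_univ _)
                    fun _ _ _ => by positivity
              _ = _ := by rw [hcr, ih3]
          · push Not at hu
            obtain ⟨s, rfl, hs⟩ := hu
            rw [ih4 s hs r hs, norm_zero, zero_pow two_ne_zero]
            exact Finset.sum_nonneg fun _ _ => by positivity
        have h1 : (1 : ℝ) ≤ ((p : ℝ) + q) * ∑ a, ‖Y a (Sum.inr t)‖ ^ 2 := by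
          rw [← hrow]
          refine (Finset.sum_le_card_nsmul _ _ _ fun u _ => hle u).trans (le_of_eq ?_)
          simp
        exact absurd (hsmall t) (not_lt.mpr h1)
      obtain ⟨s₀, hs₀⟩ := Sum.isLeft_iff.mp hleft
      have hrs₀ : r ≤ s₀ := z1 s₀ hs₀
      have hQ := mem_unitaryGroup_iff.mp z3
      have hQ' := mem_unitaryGroup_iff'.mp z3
      rw [star_eq_conjTranspose] at hQ hQ'
      have hswap : ∀ a u, (Z k * Matrix.swap ℂ (Sum.inl r) (c r)) a u =
          Z k a (Equiv.swap (Sum.inl r) (c r) u) := fun a u =>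
        congrFun (vecMul_swap (Sum.inl r) (c r) (Z k a)) u
      refine ⟨?_, ?_, ?_, ?_⟩
      · intro s hs
        rcases Nat.lt_succ_iff_lt_or_eq.mp hs with hs | hs
        · exact ih1 s hs
        · rwa [show s = r from Fin.ext hs]
      · rw [z5]
        simp only [conjTranspose_mul, conjTranspose_conjTranspose, conjTranspose_swap]
        calc (Q r)ᴴ * (Z k * Matrix.swap ℂ (Sum.inl r) (c r)) *
              (Matrix.swap ℂ (Sum.inl r) (c r) * (Z k)ᴴ * Q r)
            = (Q r)ᴴ * (Z k * (Matrix.swap ℂ (Sum.inl r) (c r) *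
              Matrix.swap ℂ (Sum.inl r) (c r)) * (Z k)ᴴ) * Q r := by simp only [Matrix.mul_assoc]
          _ = 1 := by rw [swap_mul_self, Matrix.mul_one, ih2, mul_one, hQ']
      · intro t
        have h1 := sum_norm_sq_mulVec (V := (Q r)ᴴ) (by rwa [conjTranspose_conjTranspose])
          fun a => Z k a (Sum.inr t)
        rw [← ih3 t, ← h1, z5]
        refine Finset.sum_congr rfl fun a _ => ?_
        congr 2
        rw [mul_apply, mulVec, dotProduct]
        refine Finset.sum_congr rfl fun d _ => ?_
        rw [hswap, hs₀, Equiv.swap_apply_of_ne_of_ne (by simp) (by simp)]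
      · intro s hs a hsa
        rcases Nat.lt_succ_iff_lt_or_eq.mp hs with hs | hs
        · have hsr : s < r := hs
          rw [z5, mul_apply]
          refine Finset.sum_eq_zero fun d _ => ?_
          rw [hswap, hs₀, Equiv.swap_apply_of_ne_of_ne (by simpa using hsr.ne)
            (by simpa using (hsr.trans_le hrs₀).ne)]
          by_cases hd : s < d
          · rw [ih4 s hs d hd, mul_zero]
          · rw [conjTranspose_apply, z4 d a (Or.inl ((not_lt.mp hd).trans_lt hsr)),
              one_apply_ne, star_zero, zero_mul]
            rintro rfl
            exact hd hsa
        · obtain rfl : s = r := Fin.ext hs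
          exact z6 a hsa
  exact (main (r + 1) r.2).1 r (Nat.lt_succ_self _)

lemma exists_permR_eq (c : Fin p → Fin p ⊕ Fin q) :
    ∃ σ : Equiv.Perm (Fin p ⊕ Fin q), permR c = σ.permMatrix ℂ := by
  unfold permR
  generalize (List.finRange p).dropWhile (fun r => (c r).isLeft) = L
  induction L with
  | nil => exact ⟨1, by simp⟩
  | cons r L ih =>
    obtain ⟨σ, hσ⟩ := ih
    -- The factors appear reversed because `permMatrix` is antimultiplicative.
    refine ⟨σ * Equiv.swap (Sum.inl r) (c r), ?_⟩
    rw [List.map_cons, List.prod_cons, hσ, Matrix.swap, permMatrix_mul]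

lemma permR_eq_one (h : ∀ r, (c r).isLeft) : permR c = 1 := by
  have : (List.finRange p).dropWhile (fun r => (c r).isLeft) = [] := by
    rw [List.dropWhile_eq_nil_iff]
    exact fun r _ => h r
  rw [permR, this, List.map_nil, List.prod_nil]

end PivotedQR

/-! ### Simple spectrum -/

section Spectrum

variable {ι : Type*} [Fintype ι] [DecidableEq ι]

lemma roots_charpoly_diagonal (d : ι → ℂ) :
    (diagonal d).charpoly.roots = Finset.univ.val.map d := by
  have h : ∏ i, (Polynomial.X - Polynomial.C (d i)) =
      ((Finset.univ.val.map d).map fun a => Polynomial.X - Polynomial.C a).prod := by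
    rw [Multiset.map_map]
    rfl
  rw [charpoly_diagonal, h, Polynomial.roots_multiset_prod_X_sub_C]

lemma charpoly_conj {U : Matrix ι ι ℂ} (hU : Uᴴ * U = 1) (A : Matrix ι ι ℂ) :
    (Uᴴ * A * U).charpoly = A.charpoly := by
  have hU' : U * Uᴴ = 1 := mul_eq_one_comm.mp hU
  rw [charpoly_mul_comm, ← mul_assoc, hU', one_mul]

lemma charpoly_of_steps {A U : ℕ → Matrix ι ι ℂ} (hU : ∀ k, (U k)ᴴ * U k = 1)
    (hstep : ∀ k, A (k + 1) = (U k)ᴴ * A k * U k) (k : ℕ) : (A k).charpoly = (A 0).charpoly := by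
  induction k with
  | zero => rfl
  | succ k ih => rw [hstep, charpoly_conj (hU k), ih]

/-- At each point `z` the value is a determinant, hence continuous in the matrix, and a complex
polynomial is determined by its values. -/
lemma charpoly_eq_of_tendsto {X : ℕ → Matrix ι ι ℂ} {G : Matrix ι ι ℂ} {P : Polynomial ℂ}
    (hX : ∀ n, (X n).charpoly = P) (hG : Tendsto X atTop (𝓝 G)) : G.charpoly = P := by
  refine Polynomial.funext fun z => ?_
  have hcont : Continuous fun Y : Matrix ι ι ℂ => Y.charpoly.eval z := by
    simp only [eval_charpoly]
    fun_prop
  refine tendsto_nhds_unique ((hcont.tendsto _).comp hG) (tendsto_const_nhds.congr fun n => ?_)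
  simp only [Function.comp_apply, hX]

lemma injective_of_charpoly_roots_nodup {d : ι → ℂ} (h : (diagonal d).charpoly.roots.Nodup) :
    Function.Injective d := by
  rw [roots_charpoly_diagonal] at h
  intro x y hxy
  exact Multiset.inj_on_of_nodup_map h x (Finset.mem_univ_val x) y (Finset.mem_univ_val y) hxy

lemma exists_unitary_diagonalization {H : Matrix ι ι ℂ} (hH : H.IsHermitian) :
    ∃ (V : Matrix ι ι ℂ) (lam : ι → ℂ), Vᴴ * V = 1 ∧ H * V = V * diagonal lam := by
  refine ⟨hH.eigenvectorUnitary, RCLike.ofReal ∘ hH.eigenvalues,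
    Unitary.coe_star_mul_self hH.eigenvectorUnitary, ?_⟩
  have h := hH.spectral_theorem
  rw [Unitary.conjStarAlgAut_apply] at h
  calc H * (hH.eigenvectorUnitary : Matrix ι ι ℂ) = _ * (hH.eigenvectorUnitary : Matrix ι ι ℂ) :=
        congrArg (· * (hH.eigenvectorUnitary : Matrix ι ι ℂ)) h
    _ = _ := by rw [mul_assoc, Unitary.coe_star_mul_self, mul_one]

lemma exists_pos_forall_le {κ : Type*} [Finite κ] (f : κ → ℝ) (hf : ∀ x, 0 < f x) :
    ∃ δ, 0 < δ ∧ ∀ x, δ ≤ f x := by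
  have h : ∀ᶠ δ in 𝓝[>] (0 : ℝ), ∀ x, δ ≤ f x := by
    rw [eventually_all]
    intro x
    filter_upwards [Ioo_mem_nhdsGT (hf x)] with δ hδ using hδ.2.le
  obtain ⟨δ, h1, h2⟩ := (h.and self_mem_nhdsWithin).exists
  exact ⟨δ, h2, h1⟩

/-- The diagonal entries of unitarily similar matrices with simple spectrum, the off-norms of
which tend to zero, are eventually uniformly separated. -/
lemma exists_diag_gap {H U : ℕ → Matrix ι ι ℂ} (hU : ∀ k, (U k)ᴴ * U k = 1)
    (hstep : ∀ k, H (k + 1) = (U k)ᴴ * H k * U k) (hs : HasSimpleEigenvalues (H 0))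
    (hoff : Tendsto (fun k => offSq (H k)) atTop (𝓝 0)) :
    ∃ δ, 0 < δ ∧ ∀ᶠ k in atTop, ∀ x y, x ≠ y → δ ≤ ‖H k x x - H k y y‖ := by
  have hfrob : ∀ k, frobSq (H k) = frobSq (H 0) := by
    intro k
    induction k with
    | zero => rfl
    | succ k ih => rw [hstep, frobSq_conj (hU k), ih]
  have hpair : ∀ x y, ∃ δ, 0 < δ ∧ (x ≠ y → ∀ᶠ k in atTop, δ ≤ ‖H k x x - H k y y‖) := by
    intro x y
    by_cases hxy : x = y
    · exact ⟨1, one_pos, fun h => absurd hxy h⟩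
    -- Without a gap, a subsequence of iterates converges to a diagonal matrix with the
    -- characteristic polynomial of `H 0` and with equal entries at `x` and `y`, contradicting
    -- simplicity.
    by_contra! hcon
    have hex : ∀ n : ℕ, ∃ k, n ≤ k ∧ ‖H k x x - H k y y‖ < 1 / ((n : ℝ) + 1) := by
      intro n
      have := (hcon (1 / ((n : ℝ) + 1)) (by positivity)).2
      obtain ⟨k, hk, hk'⟩ := frequently_atTop.mp this n
      exact ⟨k, hk, by simpa using hk'⟩
    choose k hk hk' using hex
    obtain ⟨φ, G, hφ, hG⟩ := exists_subseq_of_bounded (fun n (_ : Unit) => H (k n))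
      (√(frobSq (H 0))) (fun n _ x y =>
        Real.le_sqrt_of_sq_le ((sq_norm_le_frobSq _ x y).trans (hfrob _).le))
    replace hG := hG ()
    have hkφ : Tendsto (fun n => k (φ n)) atTop atTop :=
      tendsto_atTop_mono (fun n => hk (φ n)) hφ.tendsto_atTop
    have hchar := charpoly_eq_of_tendsto (fun n => charpoly_of_steps hU hstep (k (φ n))) hG
    have hdiag : G () = diagonal fun z => G () z z := by
      have h0 : offSq (G ()) = 0 :=
        tendsto_nhds_unique ((continuous_offSq.tendsto _).comp hG) (hoff.comp hkφ)
      ext z w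
      by_cases hzw : z = w
      · rw [hzw, diagonal_apply_eq]
      · rw [diagonal_apply_ne _ hzw, offSq_eq_zero_iff.mp h0 z w hzw]
    have heq : G () x x = G () y y := by
      have hcont : Continuous fun X : Matrix ι ι ℂ => ‖X x x - X y y‖ := by fun_prop
      have h1 : Tendsto (fun n => 1 / (((φ n : ℕ) : ℝ) + 1)) atTop (𝓝 0) :=
        tendsto_one_div_add_atTop_nhds_zero_nat.comp hφ.tendsto_atTop
      have h2 := le_of_tendsto_of_tendsto' ((hcont.tendsto _).comp hG) h1
        (fun n => (hk' (φ n)).le)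
      exact sub_eq_zero.mp (norm_le_zero_iff.mp h2)
    rw [HasSimpleEigenvalues, ← hchar, hdiag] at hs
    exact hxy (injective_of_charpoly_roots_nodup hs heq)
  choose δ hδ hδ' using hpair
  obtain ⟨δ₀, h0, h0'⟩ := exists_pos_forall_le (fun z : ι × ι => δ z.1 z.2) (fun z => hδ _ _)
  refine ⟨δ₀, h0, ?_⟩
  simp only [eventually_all]
  intro x y hxy
  filter_upwards [hδ' x y hxy] with k hk using (h0' (x, y)).trans hk

/-- If, moreover, the diagonal entries change by at most the off-norm, then the matrices
converge. -/
lemma tendsto_diagonal_of_diag_change {H U : ℕ → Matrix ι ι ℂ} (hH : (H 0).IsHermitian)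
    (hU : ∀ k, (U k)ᴴ * U k = 1) (hstep : ∀ k, H (k + 1) = (U k)ᴴ * H k * U k)
    (hs : HasSimpleEigenvalues (H 0)) (hoff : Tendsto (fun k => offSq (H k)) atTop (𝓝 0))
    (hdiag : ∀ᶠ k in atTop, ∀ x, ‖H (k + 1) x x - H k x x‖ ≤ √(offSq (H k))) :
    ∃ d : ι → ℂ, Tendsto H atTop (𝓝 (diagonal d)) := by
  obtain ⟨V, lam, hV, hHV⟩ := exists_unitary_diagonalization hH
  have hlam : Function.Injective lam := by
    apply injective_of_charpoly_roots_nodup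
    have h1 : diagonal lam = Vᴴ * H 0 * V := by rw [mul_assoc, hHV, ← mul_assoc, hV, one_mul]
    rw [h1, charpoly_conj hV]
    exact hs
  obtain ⟨δ, hδ, hδ'⟩ := exists_pos_forall_le
    (fun z : {z : ι × ι // z.1 ≠ z.2} => ‖lam z.1.1 - lam z.1.2‖)
    (fun z => norm_pos_iff.mpr (sub_ne_zero.mpr (hlam.ne z.2)))
  -- All iterates are diagonalized with the same list `lam`, so one indexing of the eigenvalues,
  -- with one gap `δ`, serves every `k`.
  have hVk : ∀ k, ∃ V : Matrix ι ι ℂ, Vᴴ * V = 1 ∧ H k * V = V * diagonal lam := by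
    intro k
    induction k with
    | zero => exact ⟨V, hV, hHV⟩
    | succ k ih =>
      obtain ⟨V, h1, h2⟩ := ih
      have hU' : U k * (U k)ᴴ = 1 := mul_eq_one_comm.mp (hU k)
      refine ⟨(U k)ᴴ * V, ?_, ?_⟩
      · rw [conjTranspose_mul, conjTranspose_conjTranspose, mul_assoc, ← mul_assoc (U k), hU',
          one_mul, h1]
      · rw [hstep, mul_assoc ((U k)ᴴ * H k), ← mul_assoc (U k), hU', one_mul, mul_assoc, h2,
          mul_assoc]
  set ε : ℕ → ℝ := fun k => √(offSq (H k)) with hε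
  have hε0 : Tendsto ε atTop (𝓝 0) := by
    have := (Real.continuous_sqrt.tendsto 0).comp hoff
    rwa [Real.sqrt_zero] at this
  have hnear : ∀ k x, ∃ y, ‖lam y - H k x x‖ ≤ ε k := by
    intro k x
    obtain ⟨V, h1, h2⟩ := hVk k
    exact exists_eigenvalue_near_diag h1 h2 (Real.sqrt_nonneg _)
      (Real.sq_sqrt (offSq_nonneg _)).ge x
  obtain ⟨K, hK⟩ := eventually_atTop.mp
    (hdiag.and (hε0.eventually_lt_const (show (0 : ℝ) < δ / 4 by linarith)))
  -- From step `K` on, the entry moves by less than `δ/4` and lies within `δ/4` of an eigenvalue, so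
  -- this eigenvalue cannot change.
  have hconst : ∀ x, ∃ y, ∀ k, K ≤ k → ‖lam y - H k x x‖ ≤ ε k := by
    intro x
    obtain ⟨y, hy⟩ := hnear K x
    refine ⟨y, fun k hk => ?_⟩
    induction k, hk using Nat.le_induction with
    | base => exact hy
    | succ k hk ih =>
      obtain ⟨y', hy'⟩ := hnear (k + 1) x
      have h1 := (hK k hk).1 x
      have h2 := (hK k hk).2
      have h3 := (hK (k + 1) (by omega)).2
      have h4 : y' = y := by
        by_contra hne
        have h5 := hδ' ⟨(y', y), hne⟩
        have h6 : ‖lam y' - lam y‖ ≤ ε (k + 1) + ε k + ε k := by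
          have e : lam y' - lam y = (lam y' - H (k + 1) x x) +
              (H (k + 1) x x - H k x x) - (lam y - H k x x) := by ring
          rw [e]
          refine (norm_sub_le _ _).trans ?_
          have := norm_add_le (lam y' - H (k + 1) x x) (H (k + 1) x x - H k x x)
          linarith
        simp only at h5
        linarith
      exact h4 ▸ hy'
  choose y hy using hconst
  refine ⟨fun x => lam (y x), ?_⟩
  refine tendsto_pi_nhds.mpr fun x => tendsto_pi_nhds.mpr fun z => ?_
  rw [tendsto_iff_norm_sub_tendsto_zero]
  refine squeeze_zero' (Eventually.of_forall fun _ => norm_nonneg _) ?_ hε0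
  filter_upwards [eventually_ge_atTop K] with k hk
  by_cases hxz : x = z
  · rw [← hxz, diagonal_apply_eq, norm_sub_rev]
    exact hy x k hk
  · rw [diagonal_apply_ne _ hxz, sub_zero]
    exact Real.le_sqrt_of_sq_le (sq_norm_le_offSq (H k) hxz)

/-! ### Polynomials in a Hermitian matrix. -/

lemma aeval_conj {U : Matrix ι ι ℂ} (hU : Uᴴ * U = 1) (H : Matrix ι ι ℂ) (P : Polynomial ℂ) :
    Polynomial.aeval (Uᴴ * H * U) P = Uᴴ * Polynomial.aeval H P * U := by
  have hU' : U * Uᴴ = 1 := mul_eq_one_comm.mp hU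
  induction P using Polynomial.induction_on with
  | C a => simp [Algebra.algebraMap_eq_smul_one, hU]
  | add p q hp hq => rw [map_add, map_add, hp, hq, mul_add, add_mul]
  | monomial n a ih =>
    rw [pow_succ, ← mul_assoc, map_mul _ _ Polynomial.X, map_mul _ _ Polynomial.X, ih,
      Polynomial.aeval_X, Polynomial.aeval_X]
    calc _ = Uᴴ * Polynomial.aeval H (Polynomial.C a * Polynomial.X ^ n) * (U * Uᴴ) * H * U := by
          simp only [mul_assoc]
      _ = _ := by rw [hU', mul_one]; simp only [mul_assoc]

lemma aeval_diagonal (d : ι → ℂ) (P : Polynomial ℂ) :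
    Polynomial.aeval (diagonal d) P = diagonal fun x => P.eval (d x) := by
  have h := Polynomial.aeval_algHom_apply (diagonalAlgHom (n := ι) (α := ℂ) ℂ) d P
  rw [diagonalAlgHom_apply] at h
  rw [h, diagonalAlgHom_apply, Polynomial.aeval_pi_apply]
  rfl

/-- A matrix that commutes with a Hermitian matrix with simple spectrum is a polynomial in it. -/
lemma exists_eq_aeval_of_commute {H A : Matrix ι ι ℂ} (hH : H.IsHermitian)
    (hs : HasSimpleEigenvalues H) (hc : A * H = H * A) :
    ∃ P : Polynomial ℂ, A = Polynomial.aeval H P := by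
  obtain ⟨V, lam, hV, hHV⟩ := exists_unitary_diagonalization hH
  have hV' : V * Vᴴ = 1 := mul_eq_one_comm.mp hV
  have h1 : diagonal lam = Vᴴ * H * V := by rw [mul_assoc, hHV, ← mul_assoc, hV, one_mul]
  have hback : ∀ M : Matrix ι ι ℂ, V * (Vᴴ * M * V) * Vᴴ = M := fun M => by
    calc V * (Vᴴ * M * V) * Vᴴ = (V * Vᴴ) * M * (V * Vᴴ) := by simp only [mul_assoc]
      _ = M := by rw [hV', one_mul, mul_one]
  have hlam : Function.Injective lam := by
    apply injective_of_charpoly_roots_nodup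
    rw [h1, charpoly_conj hV]
    exact hs
  set M := Vᴴ * A * V with hM
  have hcomm : M * diagonal lam = diagonal lam * M := by
    have : ∀ X Y : Matrix ι ι ℂ, Vᴴ * X * V * (Vᴴ * Y * V) = Vᴴ * (X * Y) * V := fun X Y => by
      calc Vᴴ * X * V * (Vᴴ * Y * V) = Vᴴ * X * (V * Vᴴ) * Y * V := by simp only [mul_assoc]
        _ = Vᴴ * (X * Y) * V := by rw [hV', mul_one]; simp only [mul_assoc]
    rw [h1, hM, this, this, hc]
  -- In an eigenbasis of `H`, commuting reads `(λ_x - λ_y) M_{xy} = 0`, so distinct eigenvalues make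
  -- `M` diagonal; interpolation at these nodes then yields the polynomial.
  have hMd : M = diagonal fun x => M x x := by
    ext x y
    by_cases hxy : x = y
    · rw [hxy, diagonal_apply_eq]
    · rw [diagonal_apply_ne _ hxy]
      have e := congrFun (congrFun hcomm x) y
      rw [mul_diagonal, diagonal_mul] at e
      have e' : (lam x - lam y) * M x y = 0 := by linear_combination -e
      exact (mul_eq_zero.mp e').resolve_left (sub_ne_zero.mpr (hlam.ne hxy))
  refine ⟨Lagrange.interpolate Finset.univ lam fun x => M x x, ?_⟩
  have h2 : M = Vᴴ * Polynomial.aeval H (Lagrange.interpolate Finset.univ lam fun x => M x x) * V := by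
    rw [← aeval_conj hV, ← h1, aeval_diagonal]
    conv_lhs => rw [hMd]
    congr 1
    funext x
    rw [Lagrange.eval_interpolate_at_node _ hlam.injOn (Finset.mem_univ x)]
  conv_lhs => rw [← hback A, ← hM, h2, hback]

end Spectrum

/-! ### The block Jacobi step -/

section BlockStep

variable {m : ℕ} {ν : Fin m → ℕ} {i j : Fin m}

/-- The position of a pivot index in the block partition. -/
def pivotEmb (ν : Fin m → ℕ) (i j : Fin m) : PivotIndex ν i j → BlockIndex ν :=
  Sum.elim (fun a => ⟨i, a⟩) fun a => ⟨j, a⟩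

lemma pivotEmb_injective (hij : i ≠ j) : Function.Injective (pivotEmb ν i j) := by
  rintro (a | a) (d | d) h
  · simpa [pivotEmb] using h
  · exact absurd (congrArg Sigma.fst h) hij
  · exact absurd (congrArg Sigma.fst h) hij.symm
  · simpa [pivotEmb] using h

lemma mem_range_pivotEmb {x : BlockIndex ν} : x ∈ Set.range (pivotEmb ν i j) ↔ x.1 = i ∨ x.1 = j := by
  constructor
  · rintro ⟨a | a, rfl⟩
    · exact Or.inl rfl
    · exact Or.inr rfl
  · obtain ⟨r, a⟩ := x
    rintro (h | h)
    · obtain rfl : r = i := h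
      exact ⟨Sum.inl a, rfl⟩
    · obtain rfl : r = j := h
      exact ⟨Sum.inr a, rfl⟩

lemma pivotSub_apply (A : BlockMatrix ν) (x y : PivotIndex ν i j) :
    pivotSub A i j x y = A (pivotEmb ν i j x) (pivotEmb ν i j y) := by
  rcases x with x | x <;> rcases y with y | y <;> rfl

/-- The pivot columns of `U` vanish outside the pivot rows, so the sum over all indices reduces to
the pivot indices. -/
lemma pivotSub_mul {A U : BlockMatrix ν} (hij : i ≠ j) (hU : IsElementary i j U) :
    pivotSub (A * U) i j = pivotSub A i j * pivotSub U i j := by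
  ext x y
  rw [pivotSub_apply, mul_apply, mul_apply]
  symm
  refine Fintype.sum_of_injective (pivotEmb ν i j) (pivotEmb_injective hij) _ _ ?_ ?_
  · intro z hz
    rw [mem_range_pivotEmb] at hz
    rw [hU z _ (by tauto), one_apply_ne, mul_zero]
    rintro rfl
    exact hz (mem_range_pivotEmb.mp ⟨y, rfl⟩)
  · intro z
    rw [pivotSub_apply, pivotSub_apply]

lemma pivotSub_conjTranspose (A : BlockMatrix ν) :
    pivotSub Aᴴ i j = (pivotSub A i j)ᴴ := by
  ext x y
  rw [pivotSub_apply, conjTranspose_apply, conjTranspose_apply, pivotSub_apply]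

lemma pivotSub_conj {H U : BlockMatrix ν} (hij : i ≠ j) (hU : IsElementary i j U) :
    pivotSub (Uᴴ * H * U) i j = (pivotSub U i j)ᴴ * pivotSub H i j * pivotSub U i j := by
  rw [pivotSub_mul hij hU]
  congr 1
  apply conjTranspose_injective
  rw [← pivotSub_conjTranspose, conjTranspose_mul, conjTranspose_mul, conjTranspose_conjTranspose,
    conjTranspose_conjTranspose, pivotSub_mul hij hU, pivotSub_conjTranspose]

lemma pivotDiag_of_isDiag {H : BlockMatrix ν} (h : (pivotSub H i j).IsDiag) :
    PivotDiag Sigma.fst i j H := by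
  intro x y hx hy hxy
  obtain ⟨x, rfl⟩ := mem_range_pivotEmb.mpr hx
  obtain ⟨y, rfl⟩ := mem_range_pivotEmb.mpr hy
  exact (pivotSub_apply H x y).symm.trans (h fun e => hxy (congrArg _ e))

lemma offSq_pivotSub_le (hij : i ≠ j) (H : BlockMatrix ν) : offSq (pivotSub H i j) ≤ offSq H := by
  set e : PivotIndex ν i j ↪ BlockIndex ν := ⟨pivotEmb ν i j, pivotEmb_injective hij⟩ with he
  have hrow : ∀ x, ∑ y ∈ Finset.univ.erase x, ‖pivotSub H i j x y‖ ^ 2 ≤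
      ∑ y ∈ Finset.univ.erase (e x), ‖H (e x) y‖ ^ 2 := by
    intro x
    simp only [pivotSub_apply]
    refine (Finset.sum_map (Finset.univ.erase x) e (fun y => ‖H (e x) y‖ ^ 2)).symm.trans_le ?_
    refine Finset.sum_le_sum_of_subset_of_nonneg ?_ fun _ _ _ => by positivity
    intro y hy
    obtain ⟨z, hz, rfl⟩ := Finset.mem_map.mp hy
    exact Finset.mem_erase.mpr
      ⟨fun h => Finset.ne_of_mem_erase hz (e.injective h), Finset.mem_univ _⟩
  refine (Finset.sum_le_sum fun x _ => hrow x).trans ?_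
  rw [← Finset.sum_map Finset.univ e
    (fun x => ∑ y ∈ Finset.univ.erase x, ‖H x y‖ ^ 2)]
  exact Finset.sum_le_sum_of_subset_of_nonneg (Finset.subset_univ _)
    fun _ _ _ => Finset.sum_nonneg fun _ _ => by positivity

/-! ### Determinant bounds from the UBC condition. -/

lemma blockDet_sigma_fst (U : BlockMatrix ν) (i : Fin m) :
    blockDet Sigma.fst i U = (block U i i).det := by
  rw [blockDet, ← det_submatrix_equiv_self (Equiv.sigmaSubtype i).symm]
  rfl

/-- `|det V|` is the product of the singular values, each at least the smallest. Determinants suit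
the compactness argument, since they depend continuously on the matrix. -/
lemma sigmaMin_pow_le_norm_det {p : ℕ} (V : Matrix (Fin p) (Fin p) ℂ) :
    sigmaMin V ^ p ≤ ‖V.det‖ := by
  have hfin : Module.finrank ℂ (EuclideanSpace ℂ (Fin p)) = p := by simp
  have h1 : (Matrix.toEuclideanLin V).normDet = ‖V.det‖ := by
    rw [LinearMap.normDet_eq_norm_det, toEuclideanLin_eq_toLin_orthonormal,
      LinearMap.det_toLin]
  rw [← h1, LinearMap.normDet_eq_prod_singularValues, hfin]
  calc sigmaMin V ^ p = ∏ _k ∈ Finset.range p, sigmaMin V := by simp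
    _ ≤ _ := by
      refine Finset.prod_le_prod (fun _ _ => LinearMap.singularValues_nonneg _ _) fun k hk => ?_
      exact LinearMap.singularValues_antitone _ (by have := Finset.mem_range.mp hk; omega)

lemma gammaBound_pos (p q : ℕ) : 0 < gammaBound p q := by
  refine lt_max_of_lt_right (one_div_pos.mpr (Real.sqrt_pos.mpr ?_))
  exact_mod_cast Nat.choose_pos (Nat.le_add_right p q)

/-- The norms of the determinants of the diagonal pivot blocks of a UBCE matrix are bounded
below. -/
lemma IsUBCE.le_norm_det {ϱ : ℝ} (hϱ : 0 < ϱ) {V : BlockMatrix ν} (h : IsUBCE ν ϱ i j V) :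
    min ((ϱ * gammaBound (ν i) (ν j)) ^ ν i) ((ϱ * gammaBound (ν i) (ν j)) ^ ν j) ≤
        ‖(block V i i).det‖ ∧
      min ((ϱ * gammaBound (ν i) (ν j)) ^ ν i) ((ϱ * gammaBound (ν i) (ν j)) ^ ν j) ≤
        ‖(block V j j).det‖ := by
  have h0 : 0 ≤ ϱ * gammaBound (ν i) (ν j) := (mul_pos hϱ (gammaBound_pos _ _)).le
  refine ⟨(min_le_left _ _).trans ?_, (min_le_right _ _).trans ?_⟩
  · exact (pow_le_pow_left₀ h0 h.sigma_ge _).trans (sigmaMin_pow_le_norm_det _)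
  · exact (pow_le_pow_left₀ h0 (h.sigma_eq ▸ h.sigma_ge) _).trans (sigmaMin_pow_le_norm_det _)

/-- For a nearly diagonal matrix, a transformation with attribute R that yields separated diagonal
entries changes the diagonal entries by at most the off-norm. -/
lemma IsCoreTransformation.norm_diag_sub_le {core : CoreAlgorithm ν} {H U : BlockMatrix ν}
    (h : IsCoreTransformation core i j H U) (hij : i ≠ j) (hH : H.IsHermitian)
    (hE : IsElementary i j U) {ε δ : ℝ} (hε : 0 ≤ ε) (hεδ : 4 * ε < δ)
    (hsmall : ((ν i : ℝ) + ν j) * (ν i * (ε / (δ - ε)) ^ 2) < 1) (hoff : offSq H ≤ ε ^ 2)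
    (hsep : ∀ x y, x ≠ y → δ ≤ ‖(Uᴴ * H * U) x x - (Uᴴ * H * U) y y‖) (x : BlockIndex ν) :
    ‖(Uᴴ * H * U) x x - H x x‖ ≤ ε := by
  obtain ⟨⟨W, c, hW, hc, hUW⟩, hdiag⟩ := h
  have hHp : (pivotSub H i j).IsHermitian := by
    rw [IsHermitian, ← pivotSub_conjTranspose, hH.eq]
  have hWu := hW.unitary hHp
  have hWu' : W * Wᴴ = 1 := mul_eq_one_comm.mp hWu
  have hoffp : offSq (pivotSub H i j) ≤ ε ^ 2 := (offSq_pivotSub_le hij H).trans hoff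
  obtain ⟨σ, hσ⟩ := exists_permR_eq c
  set D := (pivotSub U i j)ᴴ * pivotSub H i j * pivotSub U i j with hD
  have hDH : ∀ y, D y y = (Uᴴ * H * U) (pivotEmb ν i j y) (pivotEmb ν i j y) := by
    intro y
    rw [hD, ← pivotSub_conj hij hE, pivotSub_apply]
  -- `W` differs from the pivot submatrix of `U` by a permutation only, so it also diagonalizes,
  -- with the entries of `D` permuted by `σ`; the assumed separation carries over.
  have hlam : Wᴴ * pivotSub H i j * W = diagonal fun y => D (σ y) (σ y) := by
    have hP : permR c * (permR c)ᴴ = 1 := by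
      rw [hσ, conjTranspose_permMatrix, ← permMatrix_mul, inv_mul_cancel, permMatrix_one]
    have hW' : W = pivotSub U i j * (permR c)ᴴ := by
      rw [hUW, mul_assoc, hP, mul_one]
    have h1 : Wᴴ * pivotSub H i j * W = permR c * D * (permR c)ᴴ := by
      rw [hW', hD]
      simp only [conjTranspose_mul, conjTranspose_conjTranspose, mul_assoc]
    rw [h1, hσ, conjTranspose_permMatrix, Equiv.Perm.permMatrix, Equiv.Perm.permMatrix,
      PEquiv.toMatrix_toPEquiv_mul, PEquiv.mul_toMatrix_toPEquiv]
    ext y z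
    by_cases hyz : y = z
    · rw [hyz, diagonal_apply_eq]
      rfl
    · rw [diagonal_apply_ne _ hyz]
      exact hdiag fun e => hyz (σ.injective e)
  have hseplam : ∀ y z, y ≠ z → δ ≤ ‖D (σ y) (σ y) - D (σ z) (σ z)‖ := by
    intro y z hyz
    rw [hDH, hDH]
    exact hsep _ _ fun e => hyz (σ.injective (pivotEmb_injective hij e))
  have hnear := hW.norm_diag_sub_le hHp hlam hε hεδ hoffp hseplam
  have hδε : 0 < δ - ε := by linarith
  have hWsmall : ∀ y z, y ≠ z → ‖W y z‖ ≤ ε / (δ - ε) := by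
    intro y z hyz
    rw [le_div_iff₀ hδε, mul_comm]
    exact norm_eigenvector_le hWu hlam hε hoffp hseplam hnear hyz
  -- The columns of `[W_{ii} W_{ij}]` in the second block consist of off-diagonal entries of `W`,
  -- which are small. So the permutation is trivial and `W` itself is the pivot submatrix of `U`.
  have hleft : ∀ r, (c r).isLeft := by
    refine hc.isLeft ?_ fun t => ?_
    · ext a d
      have := congrFun (congrFun hWu' (Sum.inl a)) (Sum.inl d)
      rw [mul_apply] at this ⊢
      simpa [one_apply] using this
    · refine lt_of_le_of_lt ?_ hsmall
      gcongr
      calc ∑ a, ‖W.submatrix Sum.inl id a (Sum.inr t)‖ ^ 2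
          ≤ ∑ _a : Fin (ν i), (ε / (δ - ε)) ^ 2 := by
            refine Finset.sum_le_sum fun a _ => ?_
            have := hWsmall (Sum.inl a) (Sum.inr t) (by simp)
            exact pow_le_pow_left₀ (norm_nonneg _) this 2
        _ = ν i * (ε / (δ - ε)) ^ 2 := by simp
  by_cases hx : x.1 = i ∨ x.1 = j
  · obtain ⟨y, rfl⟩ := mem_range_pivotEmb.mpr hx
    have h1 := hnear y
    have h2 := congrFun (congrFun hlam y) y
    rw [diagonal_apply_eq] at h2
    rw [permR_eq_one hleft, mul_one] at hUW
    rw [← h2, ← hUW, ← hD, hDH, pivotSub_apply] at h1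
    rwa [norm_sub_rev]
  · have hE' : IsElementaryAt Sigma.fst i j U := hE
    rw [hE'.conj_apply (by tauto) (by tauto), hE'.mul_apply_of_ne (by tauto) (by tauto), sub_self,
      norm_zero]
    exact hε

end BlockStep

/-! ### Convergence -/

/-- Convergence of the block Jacobi process of a matrix `A` that commutes with a Hermitian matrix
`H` with simple spectrum from which the transformations are computed. -/
theorem convergesToEigenvalues_of_commute {m : ℕ} (hm : 2 ≤ m) {ν : Fin m → ℕ}
    {O : List (Fin m × Fin m)} (hO : O ∈ generalizedSerial m)
    {pivot : ℕ → Fin m × Fin m} (hpivot : IsCyclicStrategy O pivot)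
    {ϱ : ℝ} (hϱ : 0 < ϱ) {core : CoreAlgorithm ν} {A H U : ℕ → BlockMatrix ν}
    (hA : ∀ k, A (k + 1) = (U k)ᴴ * A k * U k) (hH : ∀ k, H (k + 1) = (U k)ᴴ * H k * U k)
    (hU : ∀ k, IsUBCE ν ϱ (pivot k).1 (pivot k).2 (U k))
    (hcore : ∀ k, IsCoreTransformation core (pivot k).1 (pivot k).2 (H k) (U k))
    (hH0 : (H 0).IsHermitian) (hs : HasSimpleEigenvalues (H 0)) (hc : A 0 * H 0 = H 0 * A 0) :
    ConvergesToEigenvalues A := by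
  have hUu : ∀ k, (U k)ᴴ * U k = 1 := fun k => mem_unitaryGroup_iff'.mp (hU k).unitary
  have hlt : ∀ k, (pivot k).1 < (pivot k).2 := fun k => (hO.1.2 _).mp (hpivot.mem k)
  have hHk := isHermitian_of_steps hH0 hH
  have hoff : Tendsto (fun k => offSq (H k)) atTop (𝓝 0) := by
    refine tendsto_offSq_zero hm hO.1 (forcesBlockDiag_of_mem_generalizedSerial hO) hpivot
      Sigma.fst H U hH0 hH hUu (fun k => (hU k).elementary) ?_
      (fun p => min ((ϱ * gammaBound (ν p.1) (ν p.2)) ^ ν p.1)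
        ((ϱ * gammaBound (ν p.1) (ν p.2)) ^ ν p.2)) ?_ ?_ ?_
    · intro k
      apply pivotDiag_of_isDiag
      rw [hH, pivotSub_conj (hlt k).ne (hU k).elementary]
      exact (hcore k).2
    · intro p _
      have := mul_pos hϱ (gammaBound_pos (ν p.1) (ν p.2))
      positivity
    · intro k
      rw [blockDet_sigma_fst]
      exact ((hU k).le_norm_det hϱ).1
    · intro k
      rw [blockDet_sigma_fst]
      exact ((hU k).le_norm_det hϱ).2
  obtain ⟨δ, hδ, hgap⟩ := exists_diag_gap hUu hH hs hoff
  have hε0 : Tendsto (fun k => √(offSq (H k))) atTop (𝓝 0) := by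
    have := (Real.continuous_sqrt.tendsto 0).comp hoff
    rwa [Real.sqrt_zero] at this
  have hsmall : ∀ p : Fin m × Fin m, ∀ᶠ k in atTop, ((ν p.1 : ℝ) + ν p.2) *
      (ν p.1 * (√(offSq (H k)) / (δ - √(offSq (H k)))) ^ 2) < 1 := by
    intro p
    -- The function vanishes at `t = 0` and is continuous there because `δ ≠ 0`.
    have hcont : ContinuousAt (fun t : ℝ => ((ν p.1 : ℝ) + ν p.2) * (ν p.1 * (t / (δ - t)) ^ 2))
        0 := by
      have : δ - 0 ≠ 0 := by rw [sub_zero]; exact hδ.ne'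
      fun_prop (disch := assumption)
    refine (hcont.tendsto.comp hε0).eventually_lt_const ?_
    simp
  have hchange : ∀ᶠ k in atTop, ∀ x, ‖H (k + 1) x x - H k x x‖ ≤ √(offSq (H k)) := by
    -- The gap is taken at `k + 1`, because the separation required is that of the diagonal entries
    -- after the step.
    filter_upwards [(tendsto_add_atTop_nat 1).eventually hgap, eventually_all.mpr hsmall,
      hε0.eventually_lt_const (show (0 : ℝ) < δ / 4 by linarith)] with k h1 h2 h3 x
    rw [hH] at h1 ⊢
    exact (hcore k).norm_diag_sub_le (hlt k).ne (hHk k) (hU k).elementary (Real.sqrt_nonneg _)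
      (by linarith) (h2 (pivot k)) (Real.sq_sqrt (offSq_nonneg _)).ge h1 x
  obtain ⟨d, hd⟩ := tendsto_diagonal_of_diag_change hH0 hUu hH hs hoff hchange
  -- A polynomial identity is preserved by simultaneous unitary similarity, so the convergence of `H
  -- k` passes to `A k = P(H k)`.
  obtain ⟨P, hP⟩ := exists_eq_aeval_of_commute hH0 hs hc
  have hAk : ∀ k, A k = Polynomial.aeval (H k) P := by
    intro k
    induction k with
    | zero => exact hP
    | succ k ih => rw [hA, hH, aeval_conj (hUu k), ih]
  have hlim : Tendsto A atTop (𝓝 (diagonal fun x => P.eval (d x))) := by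
    rw [← aeval_diagonal]
    exact ((P.continuous_aeval.tendsto _).comp hd).congr fun k => (hAk k).symm
  refine ⟨_, ?_, hlim⟩
  rw [← roots_charpoly_diagonal, charpoly_eq_of_tendsto (charpoly_of_steps hUu hA) hlim]

end BlockJacobi

end

open BlockJacobi
-- Normality means that `A 0` commutes with its adjoint, hence with both of its Hermitian
-- components, and these components are transformed by the same unitary similarities as `A k`. Each
-- claim is thus an instance of `convergesToEigenvalues_of_commute`.
theorem mainTheorem6 {m : ℕ} (hm : 2 ≤ m) (ν : Fin m → ℕ) (hν : ∀ r, 1 ≤ ν r)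
    (O : List (Fin m × Fin m)) (hO : O ∈ generalizedSerial m)
    (pivot : ℕ → Fin m × Fin m) (hpivot : IsCyclicStrategy O pivot)
    (ϱ : ℝ) (hϱ_pos : 0 < ϱ) (hϱ_le : ϱ ≤ 1)
    (core : CoreAlgorithm ν) (hcore : ∀ i j : Fin m, i < j → (core i j).Convergent)
    (A U : ℕ → BlockMatrix ν) (hA : IsStarNormal (A 0))
    (hstep : ∀ k, A (k + 1) = (U k)ᴴ * A k * U k)
    (hU : ∀ k, IsUBCE ν ϱ (pivot k).1 (pivot k).2 (U k)) :
    ((∀ k, IsCoreTransformation core (pivot k).1 (pivot k).2 (hermPart (A k)) (U k)) →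
      HasSimpleEigenvalues (hermPart (A 0)) → ConvergesToEigenvalues A) ∧
    ((∀ k, IsCoreTransformation core (pivot k).1 (pivot k).2 (imPart (A k)) (U k)) →
      HasSimpleEigenvalues (imPart (A 0)) → ConvergesToEigenvalues A) := by
  have hnormal : (A 0)ᴴ * A 0 = A 0 * (A 0)ᴴ := hA.star_comm_self
  have hstep' : ∀ k, (A (k + 1))ᴴ = (U k)ᴴ * (A k)ᴴ * U k := fun k => by
    rw [hstep]
    simp only [conjTranspose_mul, conjTranspose_conjTranspose, mul_assoc]
  refine ⟨fun h hs => ?_, fun h hs => ?_⟩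
  · refine convergesToEigenvalues_of_commute hm hO hpivot hϱ_pos hstep (fun k => ?_) hU h ?_ hs ?_
    · rw [hermPart, hermPart, hstep', hstep, mul_smul_comm, smul_mul_assoc, mul_add, add_mul]
    · rw [IsHermitian, hermPart, conjTranspose_smul, conjTranspose_add,
        conjTranspose_conjTranspose, add_comm]
      congr 1
      simp
    · rw [hermPart, mul_smul_comm, smul_mul_assoc, mul_add, add_mul, hnormal]
  · refine convergesToEigenvalues_of_commute hm hO hpivot hϱ_pos hstep (fun k => ?_) hU h ?_ hs ?_
    · rw [imPart, imPart, hstep', hstep, mul_smul_comm, smul_mul_assoc, mul_sub, sub_mul]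
    · rw [IsHermitian, imPart, conjTranspose_smul, conjTranspose_sub,
        conjTranspose_conjTranspose, ← neg_sub (A 0)ᴴ, smul_neg, ← neg_smul]
      congr 1
      simp [neg_div]
    · rw [imPart, mul_smul_comm, smul_mul_assoc, mul_sub, sub_mul, hnormal]
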